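/- Let $M$ be a compact complex manifold (Hausdorff, without boundary) of complex dimension $4$, and let $\psi$ be a complex-valued differential form of degree $4$ on $M$ such that about every point of $M$ there are holomorphic local coordinates $(z^1,z^2,z^3,z^4)$ in which $$\psi=f(z^1,z^2,\bar z^3,\bar z^4)\,dz^1\wedge dz^2\wedge d\bar z^3\wedge d\bar z^4 \qquad (1)$$ with $f$ a holomorphic function of four complex variables (defined on the set of the points $(z^1,z^2,\bar z^3,\bar z^4)$ in question); in particular $\psi$ is a $(2,2)$-form. Call a smooth Hermitian metric $\sum_{\alpha,\beta} g_{\alpha\bar\beta}\,dz^\alpha\otimes d\bar z^\beta$ on $M$ adapted to $\psi$ if about every point $z_0\in M$ there are holomorphic local coordinates in which $\psi$ has the form (1), with $f$ holomorphic, and in which $g_{\alpha\bar\beta}(z_0)=\delta_{\alpha\beta}$ (so that $\det(g_{\alpha\bar\beta}(z_0))=1$). Then: 1. there is a Hermitian metric on $M$ adapted to $\psi$; 2. for every Hermitian metric on $M$ adapted to $\psi$ one has $\Delta\psi=0$. Here $\Delta=d\delta+\delta d$, $\delta=-{*}\,d\,{*}$, and the Hodge star $*$ is defined by $\varphi\wedge{*\psi}=(\varphi,\psi)\,\omega^4/4!$,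 where $\omega=i\sum_{\alpha,\beta} g_{\alpha\bar\beta}\,dz^\alpha\wedge d\bar z^\beta$ and $(\cdot,\cdot)$ is the pointwise Hermitian inner product of forms for which the products of distinct members of $dz^1,\dots,dz^4,d\bar z^1,\dots,d\bar z^4$ are orthonormal wherever $g_{\alpha\bar\beta}=\delta_{\alpha\beta}$. -/

import Mathlib

open scoped Manifold ContDiff

noncomputable section

namespace ComplexFourfold

/-- The model space `ℂ⁴`, with coordinates `z¹, z², z³, z⁴` numbered `0, 1, 2, 3`. -/
abbrev C4 : Type := Fin 4 → ℂ

/-! ### Linear algebra: the Hodge star of a Hermitian inner product on `ℂ⁴` -/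

/-- The real basis `∂/∂x¹, ∂/∂y¹, …, ∂/∂x⁴, ∂/∂y⁴` of `ℂ⁴`. -/
def realFrame : Fin 8 → C4 :=
  ![Pi.single 0 1, Pi.single 0 Complex.I, Pi.single 1 1, Pi.single 1 Complex.I,
    Pi.single 2 1, Pi.single 2 Complex.I, Pi.single 3 1, Pi.single 3 Complex.I]

/-- The real coordinates `x¹, y¹, …, x⁴, y⁴` of a vector of `ℂ⁴`. -/
def realCoord (v : C4) : Fin 8 → ℝ :=
  ![(v 0).re, (v 0).im, (v 1).re, (v 1).im, (v 2).re, (v 2).im, (v 3).re, (v 3).im]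

/-- The real-linear alternating form `dx¹ ∧ dy¹ ∧ ⋯ ∧ dx⁴ ∧ dy⁴` (regarded as complex valued). -/
def stdVol : C4 [⋀^Fin 8]→L[ℝ] ℂ where
  toFun v := ((Matrix.det (Matrix.of fun i => realCoord (v i)) : ℝ) : ℂ)
  map_update_add' v i x y := by
    rename_i inst
    obtain rfl : inst = instDecidableEqFin 8 := Subsingleton.elim _ _
    have h : ∀ w : C4, (Matrix.of fun j => realCoord (Function.update v i w j)) =
        Matrix.updateRow (Matrix.of fun j => realCoord (v j)) i (realCoord w) := by
      intro w
      ext j m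
      by_cases hj : j = i
      · subst hj; simp
      · simp [hj]
    have hadd : realCoord (x + y) = realCoord x + realCoord y := by
      ext m
      fin_cases m <;> simp [realCoord]
    simp only [h, hadd, Matrix.det_updateRow_add, Complex.ofReal_add]
  map_update_smul' v i c x := by
    rename_i inst
    obtain rfl : inst = instDecidableEqFin 8 := Subsingleton.elim _ _
    have h : ∀ w : C4, (Matrix.of fun j => realCoord (Function.update v i w j)) =
        Matrix.updateRow (Matrix.of fun j => realCoord (v j)) i (realCoord w) := by
      intro w
      ext j m
      by_cases hj : j = i
      · subst hj; simp
      · simp [hj]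
    have hsmul : realCoord (c • x) = c • realCoord x := by
      ext m
      fin_cases m <;> simp [realCoord]
    simp only [h, hsmul, Matrix.det_updateRow_smul, Complex.ofReal_mul, Complex.real_smul]
  map_eq_zero_of_eq' v i j hv hij := by
    have : Matrix.det (Matrix.of fun i => realCoord (v i)) = 0 :=
      Matrix.det_zero_of_row_eq hij (by ext m; simp [hv])
    simp [this]
  cont := by
    refine Complex.continuous_ofReal.comp (Continuous.matrix_det ?_)
    refine continuous_pi fun i => continuous_pi fun m => ?_
    fin_cases m <;> simp [realCoord] <;> fun_prop

/-- The interior product `w ↦ V (a₁, …, a_k, w₁, …, w_l)`. -/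
def contract {k l n : ℕ} (hkl : k + l = n) (V : C4 [⋀^Fin n]→L[ℝ] ℂ) (a : Fin k → C4) :
    C4 [⋀^Fin l]→L[ℝ] ℂ where
  toFun w := V fun m => Fin.append a w (Fin.cast hkl.symm m)
  map_update_add' w i x y := by
    rename_i inst
    obtain rfl : inst = instDecidableEqFin l := Subsingleton.elim _ _
    subst hkl
    have h : ∀ z : C4, (fun m => Fin.append a (Function.update w i z) (Fin.cast rfl m)) =
        Function.update (Fin.append a w) (Fin.natAdd k i) z := by
      intro z
      ext1 m
      refine Fin.addCases (fun p => ?_) (fun p => ?_) m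
      · have : Fin.castAdd l p ≠ Fin.natAdd k i := by
          intro h; have := congrArg Fin.val h; simp at this; omega
        simp [this]
      · by_cases hp : p = i
        · subst hp; simp
        · have : Fin.natAdd k p ≠ Fin.natAdd k i := by simpa using hp
          simp [this, hp]
    simp only [h, ContinuousAlternatingMap.map_update_add]
  map_update_smul' w i c x := by
    rename_i inst
    obtain rfl : inst = instDecidableEqFin l := Subsingleton.elim _ _
    subst hkl
    have h : ∀ z : C4, (fun m => Fin.append a (Function.update w i z) (Fin.cast rfl m)) =
        Function.update (Fin.append a w) (Fin.natAdd k i) z := by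
      intro z
      ext1 m
      refine Fin.addCases (fun p => ?_) (fun p => ?_) m
      · have : Fin.castAdd l p ≠ Fin.natAdd k i := by
          intro h; have := congrArg Fin.val h; simp at this; omega
        simp [this]
      · by_cases hp : p = i
        · subst hp; simp
        · have : Fin.natAdd k p ≠ Fin.natAdd k i := by simpa using hp
          simp [this, hp]
    simp only [h, ContinuousAlternatingMap.map_update_smul]
  map_eq_zero_of_eq' w i j hw hij := by
    subst hkl
    refine V.map_eq_zero_of_eq _ (i := Fin.natAdd k i) (j := Fin.natAdd k j) ?_ ?_
    · simpa using hw
    · simpa using hij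
  cont := by
    subst hkl
    refine V.cont.comp (continuous_pi fun m => ?_)
    refine Fin.addCases (fun p => ?_) (fun p => ?_) m
    · simpa using continuous_const
    · simpa using continuous_apply p

/-- Sesquilinear forms on `ℂ⁴`, linear in the first and conjugate linear in the second variable. -/
abbrev Sesq : Type := C4 →L[ℂ] C4 →L⋆[ℂ] ℂ

/-- The components `g_{αβ̄} = H(∂/∂z^α, ∂/∂z^β)`, so that `H = ∑ g_{αβ̄} dz^α ⊗ dz̄^β`. -/
def Sesq.coeff (H : Sesq) : Matrix (Fin 4) (Fin 4) ℂ :=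
  Matrix.of fun α β => H (Pi.single α 1) (Pi.single β 1)

/-- The Gram matrix, in `realFrame`, of the real inner product `2 Re H`. It is the inner product
for which `dz¹, …, dz⁴` are orthonormal when `g_{αβ̄} = δ_{αβ}`. -/
def Sesq.gram (H : Sesq) : Matrix (Fin 8) (Fin 8) ℝ :=
  Matrix.of fun i j => 2 * (H (realFrame i) (realFrame j)).re

/-- The basis reciprocal to `realFrame` for the inner product `2 Re H`. -/
def Sesq.dualFrame (H : Sesq) (i : Fin 8) : C4 := ∑ j, (H.gram⁻¹) i j • realFrame j

/-- The Riemannian volume form of `2 Re H`, which is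
`ω⁴/4! = det (g_{αβ̄}) (i dz¹ ∧ dz̄¹) ∧ ⋯ ∧ (i dz⁴ ∧ dz̄⁴) = 2⁴ det (g_{αβ̄}) dx¹ ∧ dy¹ ∧ ⋯ ∧ dy⁴`
for `ω = i ∑ g_{αβ̄} dz^α ∧ dz̄^β`. -/
def Sesq.vol (H : Sesq) : C4 [⋀^Fin 8]→L[ℝ] ℂ := ((2 : ℂ) ^ 4 * H.coeff.det) • stdVol

/-- The (conjugate linear) Hodge star `Λ^k → Λ^l`, `k + l = 8`, characterized by
`φ ∧ *ψ = ⟨φ, ψ⟩ vol`; explicitly, with `b_i` a real basis and `b^i` the reciprocal basis,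
`(*ψ)(w) = (1/k!) ∑_{i₁, …, i_k} conj (ψ(b^{i₁}, …, b^{i_k})) vol(b_{i₁}, …, b_{i_k}, w)`. -/
def Sesq.star (H : Sesq) {k l : ℕ} (hkl : k + l = 8) (ψ : C4 [⋀^Fin k]→L[ℝ] ℂ) :
    C4 [⋀^Fin l]→L[ℝ] ℂ :=
  ((k.factorial : ℂ)⁻¹) • ∑ i : Fin k → Fin 8,
    (starRingEnd ℂ (ψ fun m => H.dualFrame (i m))) •
      contract hkl H.vol (fun m => realFrame (i m))

/-- The involution `(z¹, z², z³, z⁴) ↦ (z¹, z², z̄³, z̄⁴)` of `ℂ⁴`. -/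
def conj34 (z : C4) : C4 := ![z 0, z 1, starRingEnd ℂ (z 2), starRingEnd ℂ (z 3)]

/-- `dz¹ ∧ dz² ∧ dz̄³ ∧ dz̄⁴` evaluated on four vectors: the determinant of the values of the four
`1`-forms on the four vectors. -/
def splitForm (v : Fin 4 → C4) : ℂ := Matrix.det (Matrix.of fun i j => conj34 (v j) i)

/-! ### Complex fourfolds: charts, forms, Hermitian metrics, the Laplacian -/

variable {M : Type*} [TopologicalSpace M] [ChartedSpace C4 M]

/-- Complex-valued differential `k`-forms on (the real `8`-manifold underlying) `M`: at each point
an alternating real-multilinear form on the real tangent space. No smoothness is built in. -/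
abbrev DForm (M : Type*) [TopologicalSpace M] [ChartedSpace C4 M] (k : ℕ) : Type _ :=
  ∀ x : M, TangentSpace 𝓘(ℝ, C4) x [⋀^Fin k]→L[ℝ] ℂ

/-- The expression of a form in a local coordinate system `e`: its pullback under `e⁻¹`,
a form on the open set `e.target` of `ℂ⁴`. -/
def inChart {k : ℕ} (η : DForm M k) (e : OpenPartialHomeomorph M C4) (u : C4) :
    C4 [⋀^Fin k]→L[ℝ] ℂ :=
  (η (e.symm u)).compContinuousLinearMap (mfderiv 𝓘(ℝ, C4) 𝓘(ℝ, C4) e.symm u)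

/-- The exterior derivative. Mathlib identifies the tangent space at `x` with the model space by
means of the preferred chart at `x`; so `dη` at `x` is the exterior derivative of the expression
of `η` in that chart. -/
def extD {k : ℕ} (η : DForm M k) : DForm M (k + 1) := fun x =>
  extDeriv (inChart η (chartAt C4 x)) (chartAt C4 x x)

/-- The components `g_{αβ̄}` at `u ∈ e.target`, in the local coordinates `e`, of a field of
sesquilinear forms on the tangent spaces. -/
def metricCoeff (h : ∀ x : M, TangentSpace 𝓘(ℂ, C4) x →L[ℂ] TangentSpace 𝓘(ℂ, C4) x →L⋆[ℂ] ℂ)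
    (e : OpenPartialHomeomorph M C4) (u : C4) : Matrix (Fin 4) (Fin 4) ℂ :=
  Matrix.of fun α β =>
    h (e.symm u) (mfderiv 𝓘(ℂ, C4) 𝓘(ℂ, C4) e.symm u (Pi.single α (1 : ℂ) : C4))
      (mfderiv 𝓘(ℂ, C4) 𝓘(ℂ, C4) e.symm u (Pi.single β (1 : ℂ) : C4))

/-- A (smooth) Hermitian metric `∑ g_{αβ̄} dz^α ⊗ dz̄^β` on `M`. -/
structure HermitianMetric (M : Type*) [TopologicalSpace M] [ChartedSpace C4 M] where
  /-- The sesquilinear form on each tangent space. -/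
  form : ∀ x : M, TangentSpace 𝓘(ℂ, C4) x →L[ℂ] TangentSpace 𝓘(ℂ, C4) x →L⋆[ℂ] ℂ
  conj_symm : ∀ (x : M) (v w : TangentSpace 𝓘(ℂ, C4) x),
    form x w v = starRingEnd ℂ (form x v w)
  pos : ∀ (x : M) (v : TangentSpace 𝓘(ℂ, C4) x), v ≠ 0 → 0 < (form x v v).re
  smooth : ∀ e ∈ IsManifold.maximalAtlas 𝓘(ℂ, C4) ω M, ∀ α β,
    ContDiffOn ℝ ∞ (fun u => metricCoeff form e u α β) e.target

/-- The sesquilinear form at `x`, on the tangent space at `x` identified with `ℂ⁴`. -/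
def HermitianMetric.at (h : HermitianMetric M) (x : M) : Sesq := h.form x

/-- The Hodge star `*` of a Hermitian metric, on `k`-forms, with values in `l`-forms, where
`k + l = 8`. -/
def HermitianMetric.star (h : HermitianMetric M) {k l : ℕ} (hkl : k + l = 8) (ψ : DForm M k) :
    DForm M l := fun x => (h.at x).star hkl (ψ x)

/-- The codifferential `δ = - * d *` from `(k + 1)`-forms to `k`-forms
(the real dimension of `M` is even). -/
def HermitianMetric.codiff (h : HermitianMetric M) {k l : ℕ} (hkl : k + l + 1 = 8)
    (ψ : DForm M (k + 1)) : DForm M k :=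
  -h.star (k := l + 1) (l := k) (by omega) (extD (h.star (k := k + 1) (l := l) (by omega) ψ))

/-- The Laplacian `Δ = d δ + δ d` on `(k + 1)`-forms, `k ≤ 6`. -/
def HermitianMetric.laplacian (h : HermitianMetric M) {k l : ℕ} (hkl : k + l + 2 = 8)
    (ψ : DForm M (k + 1)) : DForm M (k + 1) :=
  extD (h.codiff (k := k) (l := l + 1) (by omega) ψ) +
    h.codiff (k := k + 1) (l := l) (by omega) (extD ψ)

/-- In the local coordinates `e = (z¹, z², z³, z⁴)` the form `ψ` is
`f(z¹, z², z̄³, z̄⁴) dz¹ ∧ dz² ∧ dz̄³ ∧ dz̄⁴` with a holomorphic function `f` of four variables. -/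
def IsSplitIn (ψ : DForm M 4) (e : OpenPartialHomeomorph M C4) : Prop :=
  ∃ f : C4 → ℂ, DifferentiableOn ℂ f (conj34 '' e.target) ∧
    ∀ u ∈ e.target, ∀ v : Fin 4 → C4, inChart ψ e u v = f (conj34 u) * splitForm v

/-- About every base point `z₀` there are holomorphic local coordinates in which `ψ` has the form
`f(z¹, z², z̄³, z̄⁴) dz¹ ∧ dz² ∧ dz̄³ ∧ dz̄⁴`, `f` holomorphic. -/
def IsLocallySplit (ψ : DForm M 4) : Prop :=
  ∀ z₀ : M, ∃ e ∈ IsManifold.maximalAtlas 𝓘(ℂ, C4) ω M, z₀ ∈ e.source ∧ IsSplitIn ψ e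

/-- About every base point `z₀` there are holomorphic local coordinates in which `ψ` has the form
`f(z¹, z², z̄³, z̄⁴) dz¹ ∧ dz² ∧ dz̄³ ∧ dz̄⁴`, `f` holomorphic, and in which the metric satisfies
`g_{αβ̄}(z₀) = δ_{αβ}`. -/
def HermitianMetric.IsAdapted (h : HermitianMetric M) (ψ : DForm M 4) : Prop :=
  ∀ z₀ : M, ∃ e ∈ IsManifold.maximalAtlas 𝓘(ℂ, C4) ω M, z₀ ∈ e.source ∧ IsSplitIn ψ e ∧
    metricCoeff h.form e (e z₀) = 1

end ComplexFourfold

end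

/-!
# Locally split `(2,2)`-forms are harmonic for adapted metrics

Write `ψ = f(z¹, z², z̄³, z̄⁴) dz¹ ∧ dz² ∧ dz̄³ ∧ dz̄⁴` in local coordinates, with `f` holomorphic.

*Harmonicity.* In the variables `w = (z¹, z², z̄³, z̄⁴)` the form is a holomorphic form of top degree,
hence closed (`IsSplitIn.closed`; by naturality of the exterior derivative this may be checked in
any chart, `extD_eq_zero`). At a point where the coordinates are orthonormal, `*ψ` is a universal
constant times the complex conjugate of `ψ` (`star_eq_smul_conj`). That relation between `*ψ` and
`ψ̄` no longer mentions the coordinates, so for an adapted metric it holds on all of `M`, although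
the adapted coordinates change from point to point; therefore `d * ψ = 0` as well, and `Δψ = 0`.
The computation of `*ψ` is one of determinants: the four covectors `dz¹, dz², dz̄³, dz̄⁴` span an
isotropic subspace, so that completing their conjugates by four vectors to an `8 × 8` determinant
detects only the `4 × 4` determinant of the conjugate covectors on these vectors
(`det_stack_conj`).

*Existence.* A partition of unity glues the flat metrics of finitely many split coordinate systems
to a metric `g`. Fix a point and split coordinates `e` about it. If `ψ` vanishes near the point, any
linear change of `e` gives split coordinates after shrinking, and some linear change makes `g`
standard at the point. Otherwise the transition maps to other split coordinates have block diagonal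
differentials wherever `ψ ≠ 0`, because they preserve `dz¹ ∧ dz² ∧ dz̄³ ∧ dz̄⁴` up to a scalar
(`commute_signMap_of_splitForm`), hence also at the point in question by continuity
(`fderiv_transition_signMap`). So `g` is block diagonal there, and the linear change given by the
inverse square root of its matrix is block diagonal too
(`exists_linChart_metricCoeff_eq_one`); such changes keep the form split (`IsSplitIn.linChart`).
-/

noncomputable section

namespace ComplexFourfold

section LinearAlgebra

open Matrix

/-! ### Alternating expansions of determinants -/

/-- The alternating map `x ↦ det (x₁, …, x_k, U₁, …, U_l)` on row vectors of length `k + l`. -/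
def detAppend {k l : ℕ} (U : Fin l → Fin (k + l) → ℂ) :
    (Fin (k + l) → ℂ) [⋀^Fin k]→ₗ[ℂ] ℂ where
  toFun x := detRowAlternating (Fin.append x U)
  map_update_add' x i a b := by
    rename_i inst
    obtain rfl : inst = instDecidableEqFin k := Subsingleton.elim _ _
    have h : ∀ z, Fin.append (Function.update x i z) U =
        Function.update (Fin.append x U) (Fin.castAdd l i) z := by
      intro z
      ext1 m
      refine Fin.addCases (fun p => ?_) (fun p => ?_) m
      · by_cases hp : p = i
        · subst hp; simp
        · have : Fin.castAdd l p ≠ Fin.castAdd l i := by simpa using hp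
          simp [this, hp]
      · have : Fin.natAdd k p ≠ Fin.castAdd l i := by
          intro h; have := congrArg Fin.val h; simp at this; omega
        simp [this]
    simp only [h, AlternatingMap.map_update_add]
  map_update_smul' x i c a := by
    rename_i inst
    obtain rfl : inst = instDecidableEqFin k := Subsingleton.elim _ _
    have h : ∀ z, Fin.append (Function.update x i z) U =
        Function.update (Fin.append x U) (Fin.castAdd l i) z := by
      intro z
      ext1 m
      refine Fin.addCases (fun p => ?_) (fun p => ?_) m
      · by_cases hp : p = i
        · subst hp; simp
        · have : Fin.castAdd l p ≠ Fin.castAdd l i := by simpa using hp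
          simp [this, hp]
      · have : Fin.natAdd k p ≠ Fin.castAdd l i := by
          intro h; have := congrArg Fin.val h; simp at this; omega
        simp [this]
    simp only [h, AlternatingMap.map_update_smul]
  map_eq_zero_of_eq' x i j hx hij :=
    AlternatingMap.map_eq_zero_of_eq _ _ (i := Fin.castAdd l i) (j := Fin.castAdd l j)
      (by simpa using hx) (by simpa using hij)

/-- The Cauchy–Binet type expansion of an alternating map on the rows of `N`: summing over all
index tuples counts every minor `k!` times. -/
lemma sum_minor_mul_alternating {k n : ℕ} (F : (Fin n → ℂ) [⋀^Fin k]→ₗ[ℂ] ℂ)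
    (N : Matrix (Fin k) (Fin n) ℂ) :
    ∑ i : Fin k → Fin n, (N.submatrix id i).det * F (fun m => Pi.single (i m) 1) =
      (k.factorial : ℂ) * F N.row := by
  have expand : ∀ N' : Matrix (Fin k) (Fin n) ℂ, F N'.row =
      ∑ i : Fin k → Fin n, (∏ m, N' m (i m)) * F (fun m => Pi.single (i m) 1) := by
    intro N'
    have h : N'.row =
        fun m => ∑ j, N' m j • (Pi.single j (1 : ℂ) : Fin n → ℂ) := by
      ext m j
      simp [Finset.sum_apply, Pi.single_apply]
    conv_lhs => rw [h]
    rw [← AlternatingMap.coe_multilinearMap, MultilinearMap.map_sum]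
    refine Finset.sum_congr rfl fun i _ => ?_
    rw [MultilinearMap.map_smul_univ]
    rfl
  have perm : ∀ σ : Equiv.Perm (Fin k),
      ∑ i : Fin k → Fin n, (∏ m, N (σ m) (i m)) * F (fun m => Pi.single (i m) 1) =
        (Equiv.Perm.sign σ : ℤ) * F N.row := by
    intro σ
    have h := expand (Matrix.of fun m => N.row (σ m))
    simp only [of_apply, row_apply] at h
    rw [← h]
    have h2 := F.map_perm N.row σ
    refine h2.trans ?_
    simp [Units.smul_def]
  simp only [det_apply', Finset.sum_mul, submatrix_apply, id]
  rw [Finset.sum_comm]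
  have : ∀ σ : Equiv.Perm (Fin k), ∑ i : Fin k → Fin n,
      (((Equiv.Perm.sign σ : ℤ) : ℂ) * ∏ m, N (σ m) (i m)) * F (fun m => Pi.single (i m) 1) =
        F N.row := by
    intro σ
    simp only [mul_assoc]
    rw [← Finset.mul_sum, perm, ← mul_assoc, ← Int.cast_mul, ← Units.val_mul,
      Int.units_mul_self]
    simp
  rw [Finset.sum_congr rfl fun σ _ => this σ]
  simp [Fintype.card_perm]

/-! ### Real coordinates -/

lemma realCoord_add (v w : C4) : realCoord (v + w) = realCoord v + realCoord w := by
  ext m; fin_cases m <;> simp [realCoord]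

lemma realCoord_smul (c : ℝ) (v : C4) : realCoord (c • v) = c • realCoord v := by
  ext m; fin_cases m <;> simp [realCoord]

lemma realCoord_realFrame (j : Fin 8) : realCoord (realFrame j) = Pi.single j 1 := by
  ext m; fin_cases j <;> fin_cases m <;> simp [realCoord, realFrame]

lemma sum_realCoord_smul_realFrame (v : C4) : ∑ j, realCoord v j • realFrame j = v := by
  ext a
  fin_cases a <;> simp [Fin.sum_univ_eight, realCoord, realFrame]

/-- `realCoord` as a linear equivalence; its inverse takes a coordinate vector to the
corresponding combination of `realFrame`. -/
def realCoordEquiv : C4 ≃ₗ[ℝ] (Fin 8 → ℝ) where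
  toFun := realCoord
  invFun c := ∑ j, c j • realFrame j
  map_add' := realCoord_add
  map_smul' := realCoord_smul
  left_inv := sum_realCoord_smul_realFrame
  right_inv c := by
    have h : realCoord (∑ j, c j • realFrame j) = ∑ j, c j • realCoord (realFrame j) := by
      let L : C4 →ₗ[ℝ] (Fin 8 → ℝ) := ⟨⟨realCoord, realCoord_add⟩, realCoord_smul⟩
      exact (map_sum L _ _).trans (Finset.sum_congr rfl fun j _ => L.map_smul _ _)
    rw [h]
    ext m
    simp [realCoord_realFrame, Pi.single_apply]

/-- The real matrix, in `realFrame`, of a complex linear map. -/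
def realMatrix (D : C4 →L[ℂ] C4) : Matrix (Fin 8) (Fin 8) ℝ :=
  Matrix.of fun i j => realCoord (D (realFrame j)) i

lemma realCoord_map (D : C4 →L[ℂ] C4) (v : C4) :
    realCoord (D v) = realMatrix D *ᵥ realCoord v := by
  conv_lhs => rw [← sum_realCoord_smul_realFrame v]
  have h : realCoord (D (∑ j, realCoord v j • realFrame j)) =
      ∑ j, realCoord v j • realCoord (D (realFrame j)) := by
    have := map_sum (realCoordEquiv.toLinearMap ∘ₗ (D.restrictScalars ℝ).toLinearMap)
      (fun j => realCoord v j • realFrame j) Finset.univ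
    refine this.trans (Finset.sum_congr rfl fun j _ => ?_)
    exact (realCoordEquiv.toLinearMap ∘ₗ (D.restrictScalars ℝ).toLinearMap).map_smul _ _
  rw [h]
  ext m
  simp [realMatrix, mulVec, dotProduct, mul_comm]

/-- The matrix of a complex linear endomorphism of `ℂ⁴`. -/
def cMatrix (D : C4 →L[ℂ] C4) : Matrix (Fin 4) (Fin 4) ℂ :=
  LinearMap.toMatrix' D.toLinearMap

/-- A complex linear map has positive real determinant. -/
lemma det_realMatrix (D : C4 →L[ℂ] C4) :
    (realMatrix D).det = Complex.normSq (cMatrix D).det := by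
  let b : Module.Basis (Fin 8) ℝ C4 := Module.Basis.ofEquivFun realCoordEquiv
  have hb : ∀ j, b j = realFrame j := by
    intro j
    simp only [b, Module.Basis.coe_ofEquivFun]
    rw [LinearEquiv.symm_apply_eq]
    exact (realCoord_realFrame j).symm
  have h1 : LinearMap.toMatrix b b (D.toLinearMap.restrictScalars ℝ) = realMatrix D := by
    ext i j
    rw [LinearMap.toMatrix_apply, hb]
    rfl
  rw [← h1, LinearMap.det_toMatrix, LinearMap.det_restrictScalars, Algebra.norm_complex_eq,
    cMatrix, LinearMap.det_toMatrix']
  rfl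

end LinearAlgebra

section Star

open Matrix

/-! ### Stacked matrices -/

section Stack

variable {k l : ℕ}

/-- The square matrix whose rows are those of `A` followed by those of `B`. -/
def stack (A : Matrix (Fin k) (Fin (k + l)) ℂ) (B : Matrix (Fin l) (Fin (k + l)) ℂ) :
    Matrix (Fin (k + l)) (Fin (k + l)) ℂ :=
  Matrix.of (Fin.append A.row B.row)

lemma stack_eq (A : Matrix (Fin k) (Fin (k + l)) ℂ) (B : Matrix (Fin l) (Fin (k + l)) ℂ) :
    stack A B = (fromRows A B).submatrix finSumFinEquiv.symm id := by
  ext i j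
  refine Fin.addCases (fun p => ?_) (fun p => ?_) i
  · rw [submatrix_apply, finSumFinEquiv_symm_apply_castAdd, stack, of_apply, Fin.append_left]
    rfl
  · rw [submatrix_apply, finSumFinEquiv_symm_apply_natAdd, stack, of_apply, Fin.append_right]
    rfl

lemma det_stack_mul (A : Matrix (Fin k) (Fin (k + l)) ℂ) (B : Matrix (Fin l) (Fin (k + l)) ℂ)
    (C : Matrix (Fin (k + l)) (Fin k) ℂ) (D : Matrix (Fin (k + l)) (Fin l) ℂ) :
    (stack A B).det * ((fromCols C D).submatrix id finSumFinEquiv.symm).det =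
      (fromBlocks (A * C) (A * D) (B * C) (B * D)).det := by
  rw [stack_eq, ← det_mul]
  have h2 := submatrix_mul (fromRows A B) (fromCols C D)
    finSumFinEquiv.symm id finSumFinEquiv.symm Function.bijective_id
  rw [← h2, det_submatrix_equiv_self, fromRows_mul_fromCols]

lemma stack_mul (A : Matrix (Fin k) (Fin (k + l)) ℂ) (B : Matrix (Fin l) (Fin (k + l)) ℂ)
    (P : Matrix (Fin (k + l)) (Fin (k + l)) ℂ) :
    stack (A * P) (B * P) = stack A B * P := by
  have h := submatrix_mul (fromRows A B) P finSumFinEquiv.symm id id Function.bijective_id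
  rw [stack_eq, stack_eq, ← fromRows_mul, h, submatrix_id_id]

lemma det_stack_eq_detAppend (A : Matrix (Fin k) (Fin (k + l)) ℂ)
    (B : Matrix (Fin l) (Fin (k + l)) ℂ) :
    (stack A B).det = detAppend B.row A.row := rfl

lemma det_stack_smul (c : ℂ) (A : Matrix (Fin k) (Fin (k + l)) ℂ)
    (B : Matrix (Fin l) (Fin (k + l)) ℂ) :
    (stack (c • A) B).det = c ^ k * (stack A B).det := by
  rw [det_stack_eq_detAppend, det_stack_eq_detAppend]
  have h := (detAppend B.row).toMultilinearMap.map_smul_univ (fun _ => c) A.row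
  simp only [Finset.prod_const, Finset.card_univ, Fintype.card_fin, smul_eq_mul] at h
  exact h

lemma sum_minor_mul_det_stack (N : Matrix (Fin k) (Fin (k + l)) ℂ)
    (B : Matrix (Fin l) (Fin (k + l)) ℂ) :
    ∑ i : Fin k → Fin (k + l), (N.submatrix id i).det *
        (stack (Matrix.of fun m => Pi.single (i m) 1) B).det =
      (k.factorial : ℂ) * (stack N B).det :=
  sum_minor_mul_alternating (detAppend B.row) N

end Stack

/-! ### The Hodge star of a split form -/

/-- The matrix of `z ↦ (z¹, z², z̄³, z̄⁴)` with respect to the real coordinates of `ℂ⁴`. -/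
def splitMatrix : Matrix (Fin 4) (Fin 8) ℂ :=
  !![1, Complex.I, 0, 0, 0, 0, 0, 0;
     0, 0, 1, Complex.I, 0, 0, 0, 0;
     0, 0, 0, 0, 1, -Complex.I, 0, 0;
     0, 0, 0, 0, 0, 0, 1, -Complex.I]

lemma conj34_eq_mulVec (v : C4) :
    conj34 v = splitMatrix *ᵥ fun j => (realCoord v j : ℂ) := by
  ext a
  fin_cases a <;>
    simp [conj34, splitMatrix, mulVec, dotProduct, Fin.sum_univ_eight, realCoord] <;>
    apply Complex.ext <;> simp

/-- The rows of `splitMatrix` are isotropic. -/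
lemma splitMatrix_mul_transpose : splitMatrix * splitMatrixᵀ = 0 := by
  ext a b
  fin_cases a <;> fin_cases b <;> simp [splitMatrix, mul_apply, Fin.sum_univ_eight]

lemma splitMatrix_mul_conj : splitMatrix * (splitMatrix.map (starRingEnd ℂ))ᵀ = (2 : ℂ) • 1 := by
  ext a b
  fin_cases a <;> fin_cases b <;>
    simp [splitMatrix, mul_apply, Fin.sum_univ_eight] <;> norm_num

lemma splitMatrix_conj_mul_transpose :
    splitMatrix.map (starRingEnd ℂ) * splitMatrixᵀ = (2 : ℂ) • 1 := by
  have := congrArg Matrix.transpose splitMatrix_mul_conj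
  simpa [transpose_mul] using this

lemma splitMatrix_conj_mul_conj :
    splitMatrix.map (starRingEnd ℂ) * (splitMatrix.map (starRingEnd ℂ))ᵀ = 0 := by
  have := congrArg (fun N => Matrix.map N (starRingEnd ℂ)) splitMatrix_mul_transpose
  simpa [Matrix.map_mul, transpose_map] using this

/-- The determinant of the `8 × 8` matrix whose columns are the rows of `splitMatrix` followed by
their complex conjugates. -/
def splitDet : ℂ :=
  ((fromCols splitMatrixᵀ (splitMatrix.map (starRingEnd ℂ))ᵀ).submatrix id
    (finSumFinEquiv (m := 4) (n := 4)).symm).det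

lemma splitDet_ne_zero : splitDet ≠ 0 := by
  intro h
  have := det_stack_mul (k := 4) (l := 4) (A := splitMatrix.map (starRingEnd ℂ)) (B := splitMatrix)
    (C := splitMatrixᵀ) (D := (splitMatrix.map (starRingEnd ℂ))ᵀ)
  rw [← splitDet, h, mul_zero, splitMatrix_conj_mul_conj, det_fromBlocks_zero₁₂,
    splitMatrix_conj_mul_transpose, splitMatrix_mul_conj] at this
  simp at this

/-- Completing the conjugate covectors to an `8`-form detects exactly the conjugate of the split
form, because the rows of `splitMatrix` span an isotropic subspace. -/
lemma det_stack_conj (W : Matrix (Fin 4) (Fin 8) ℂ) :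
    (stack (k := 4) (l := 4) (splitMatrix.map (starRingEnd ℂ)) W).det =
      16 / splitDet * (splitMatrix.map (starRingEnd ℂ) * Wᵀ).det := by
  have := det_stack_mul (k := 4) (l := 4) (A := splitMatrix.map (starRingEnd ℂ)) (B := W)
    (C := splitMatrixᵀ) (D := (splitMatrix.map (starRingEnd ℂ))ᵀ)
  rw [← splitDet, splitMatrix_conj_mul_conj, det_fromBlocks_zero₁₂,
    splitMatrix_conj_mul_transpose, ← transpose_transpose (W * _), det_transpose,
    transpose_mul, transpose_transpose] at this
  rw [div_mul_eq_mul_div, eq_div_iff splitDet_ne_zero, this]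
  norm_num [det_smul]

lemma splitForm_eq_det (v : Fin 4 → C4) :
    splitForm v =
      (splitMatrix * (Matrix.of fun m j => (realCoord (v m) j : ℂ))ᵀ).det := by
  rw [splitForm]
  congr 1
  ext i j
  simp [conj34_eq_mulVec, mul_apply, mulVec, dotProduct]

lemma stdVol_apply (v : Fin 8 → C4) :
    stdVol v = (Matrix.of fun i j => (realCoord (v i) j : ℂ)).det := by
  have : (Matrix.of fun i j => (realCoord (v i) j : ℂ)) =
      (Matrix.of fun i => realCoord (v i)).map Complex.ofRealHom := rfl
  rw [this]
  exact RingHom.map_det Complex.ofRealHom _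

lemma Sesq.star_apply (H : Sesq) {k l : ℕ} (hkl : k + l = 8) (ψ : C4 [⋀^Fin k]→L[ℝ] ℂ)
    (w : Fin l → C4) :
    H.star hkl ψ w = ((k.factorial : ℂ)⁻¹) * ∑ i : Fin k → Fin 8,
      starRingEnd ℂ (ψ fun m => H.dualFrame (i m)) *
        contract hkl H.vol (fun m => realFrame (i m)) w := by
  simp [Sesq.star]

section Orthonormal

variable {H : Sesq} {D : C4 →L[ℂ] C4}

/-- If `D` carries the standard basis to an orthonormal one, it pulls `H` back to the standard
Hermitian form. -/
lemma sesq_comp_eq (hD : ∀ α β, H (D (Pi.single α 1)) (D (Pi.single β 1)) = if α = β then 1 else 0)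
    (v w : C4) : H (D v) (D w) = ∑ α, v α * starRingEnd ℂ (w α) := by
  have expand : ∀ v : C4, D v = ∑ α, v α • D (Pi.single α 1) := by
    intro v
    conv_lhs => rw [pi_eq_sum_univ' v]
    rw [map_sum]
    refine Finset.sum_congr rfl fun α _ => ?_
    rw [map_smul]
  rw [expand v, expand w]
  simp [map_sum, hD, mul_comm]

lemma coeff_mul_eq_one
    (hD : ∀ α β, H (D (Pi.single α 1)) (D (Pi.single β 1)) = if α = β then 1 else 0) :
    (cMatrix D)ᵀ * H.coeff * (cMatrix D).map (starRingEnd ℂ) = 1 := by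
  have expand : ∀ α, D (Pi.single α 1) = ∑ γ, cMatrix D γ α • (Pi.single γ 1 : C4) := by
    intro α
    ext γ
    simp [cMatrix, LinearMap.toMatrix'_apply, Finset.sum_apply, Pi.single_apply]
  ext α β
  have h := hD α β
  rw [expand α, expand β] at h
  simp only [map_sum, map_smul, _root_.sum_apply, _root_.smul_apply,
    map_smulₛₗ, smul_eq_mul] at h
  rw [one_apply, ← h]
  simp only [mul_apply, Sesq.coeff, transpose_apply, map_apply, of_apply, Finset.sum_mul,
    Finset.mul_sum]
  refine Finset.sum_congr rfl fun γ _ => Finset.sum_congr rfl fun δ _ => ?_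
  ring

/-- The determinant of the metric is the inverse of the real Jacobian of an orthonormal frame;
so the volume form of `H` is the standard one in orthonormal coordinates. -/
lemma det_coeff_mul_det_realMatrix
    (hD : ∀ α β, H (D (Pi.single α 1)) (D (Pi.single β 1)) = if α = β then 1 else 0) :
    H.coeff.det * ((realMatrix D).det : ℂ) = 1 := by
  have h := congrArg det (coeff_mul_eq_one hD)
  rw [det_mul, det_mul, det_transpose, det_one] at h
  have h2 : ((cMatrix D).map (starRingEnd ℂ)).det = starRingEnd ℂ (cMatrix D).det :=
    (RingHom.map_det (starRingEnd ℂ) _).symm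
  rw [h2] at h
  rw [det_realMatrix, Complex.normSq_eq_conj_mul_self, ← h]
  ring

lemma gram_inv
    (hD : ∀ α β, H (D (Pi.single α 1)) (D (Pi.single β 1)) = if α = β then 1 else 0) :
    H.gram⁻¹ = (2⁻¹ : ℝ) • (realMatrix D * (realMatrix D)ᵀ) := by
  have hdet : IsUnit (realMatrix D).det := by
    refine isUnit_iff_ne_zero.2 fun h => ?_
    have := det_coeff_mul_det_realMatrix hD
    simp [h] at this
  have key : (realMatrix D)ᵀ * H.gram * realMatrix D = (2 : ℝ) • 1 := by
    have hcol : ∀ j, D (realFrame j) = ∑ k, realMatrix D k j • realFrame k := fun j =>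
      (sum_realCoord_smul_realFrame _).symm
    have hsm : ∀ (r : ℝ) (v w : C4), H (r • v) w = r • H v w := fun r v w => by
      have : r • v = (r : ℂ) • v := by ext; simp
      rw [this, map_smul]; simp
    have hsm' : ∀ (r : ℝ) (v w : C4), H v (r • w) = r • H v w := fun r v w => by
      have : r • w = (r : ℂ) • w := by ext; simp
      rw [this, map_smulₛₗ]; simp
    ext i j
    have h := sesq_comp_eq hD (realFrame i) (realFrame j)
    have h1 : ((realMatrix D)ᵀ * H.gram * realMatrix D) i j =
        2 * (H (D (realFrame i)) (D (realFrame j))).re := by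
      rw [hcol i, hcol j]
      simp only [map_sum, _root_.sum_apply, hsm, hsm', Complex.re_sum,
        Complex.smul_re, mul_apply, Sesq.gram, of_apply, transpose_apply, Finset.sum_mul,
        Finset.mul_sum, smul_eq_mul]
      refine Finset.sum_congr rfl fun γ _ => Finset.sum_congr rfl fun δ _ => ?_
      ring
    rw [h1, h]
    fin_cases i <;> fin_cases j <;> simp [realFrame, Fin.sum_univ_four, one_apply]
  refine inv_eq_right_inv ?_
  have hB : IsUnit (realMatrix D) := (isUnit_iff_isUnit_det _).2 hdet
  have hBt : IsUnit (realMatrix D)ᵀ := (isUnit_iff_isUnit_det _).2 (by rwa [det_transpose])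
  apply hBt.mul_left_cancel
  calc (realMatrix D)ᵀ * (H.gram * ((2⁻¹ : ℝ) • (realMatrix D * (realMatrix D)ᵀ)))
      = (2⁻¹ : ℝ) • (((realMatrix D)ᵀ * H.gram * realMatrix D) * (realMatrix D)ᵀ) := by
        simp only [Matrix.mul_smul, Matrix.mul_assoc]
    _ = (realMatrix D)ᵀ * 1 := by rw [key]; simp

/-- The reciprocal basis, expressed in orthonormal coordinates: its coordinates are half the rows of
the Jacobian matrix. -/
lemma dualFrame_eq
    (hD : ∀ α β, H (D (Pi.single α 1)) (D (Pi.single β 1)) = if α = β then 1 else 0)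
    (i : Fin 8) :
    H.dualFrame i = D (∑ j, (2⁻¹ * realMatrix D i j) • realFrame j) := by
  apply realCoordEquiv.injective
  have h : ∀ c : Fin 8 → ℝ, realCoord (∑ j, c j • realFrame j) = c :=
    realCoordEquiv.right_inv
  change realCoord _ = realCoord _
  rw [realCoord_map, h, Sesq.dualFrame, h, gram_inv hD]
  ext j
  simp only [Matrix.smul_apply, mul_apply, transpose_apply, mulVec, dotProduct, smul_eq_mul,
    Finset.mul_sum]
  refine Finset.sum_congr rfl fun k _ => ?_
  ring

/-- The Hodge star of a multiple of `dz¹ ∧ dz² ∧ dz̄³ ∧ dz̄⁴`, in coordinates that are orthonormal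
for the metric, is a universal multiple of the complex conjugate form. -/
theorem star_eq_smul_conj
    (hD : ∀ α β, H (D (Pi.single α 1)) (D (Pi.single β 1)) = if α = β then 1 else 0)
    {ψ : C4 [⋀^Fin 4]→L[ℝ] ℂ} {f : ℂ} (hψ : ∀ v, ψ (fun m => D (v m)) = f * splitForm v)
    (hkl : 4 + 4 = 8) (w : Fin 4 → C4) :
    H.star hkl ψ w = 16 / splitDet * starRingEnd ℂ (ψ w) := by
  have hdet : IsUnit (realMatrix D).det := by
    refine isUnit_iff_ne_zero.2 fun h => ?_
    have := det_coeff_mul_det_realMatrix hD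
    simp [h] at this
  -- `D` is surjective, so `ψ` and `*ψ` may be evaluated in the coordinates given by `D`.
  obtain ⟨w', rfl⟩ : ∃ w' : Fin 4 → C4, w = fun m => D (w' m) := by
    have : ∀ y : C4, ∃ x, y = D x := by
      intro y
      refine ⟨realCoordEquiv.symm ((realMatrix D)⁻¹ *ᵥ realCoord y), ?_⟩
      apply realCoordEquiv.injective
      change realCoord y = realCoord _
      rw [realCoord_map]
      change _ = _ *ᵥ (realCoordEquiv (realCoordEquiv.symm _))
      rw [LinearEquiv.apply_symm_apply, mulVec_mulVec, mul_nonsing_inv _ hdet, one_mulVec]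
    choose g hg using this
    exact ⟨fun m => g (w m), funext fun m => hg _⟩
  set B : Matrix (Fin 8) (Fin 8) ℂ := (realMatrix D).map Complex.ofRealHom with hB
  set W : Matrix (Fin 4) (Fin 8) ℂ := Matrix.of fun m j => (realCoord (w' m) j : ℂ) with hW
  set N : Matrix (Fin 4) (Fin 8) ℂ := (2⁻¹ : ℂ) • (splitMatrix.map (starRingEnd ℂ) * Bᵀ) with hN
  -- The two factors of each summand of `*ψ` are a minor of `N`, and the determinant of four unit
  -- rows stacked on `W * Bᵀ`, so that the sum is the determinant of `N` stacked on `W * Bᵀ`; the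
  -- common right factor `Bᵀ` then splits off.
  have h1 : ∀ i : Fin 4 → Fin 8, starRingEnd ℂ (ψ fun m => H.dualFrame (i m)) =
      starRingEnd ℂ f * (N.submatrix id i).det := by
    intro i
    simp only [dualFrame_eq hD]
    rw [hψ, map_mul, splitForm, RingHom.map_det]
    congr 2
    ext a m
    have h : ∀ c : Fin 8 → ℝ, realCoord (∑ j, c j • realFrame j) = c :=
      realCoordEquiv.right_inv
    simp only [RingHom.mapMatrix_apply, map_apply, of_apply, conj34_eq_mulVec, h, mulVec,
      dotProduct, map_sum, map_mul, hN, submatrix_apply, Matrix.smul_apply, mul_apply, transpose_apply,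
      hB, smul_eq_mul, Finset.mul_sum, id, Complex.conj_ofReal, Complex.ofReal_mul,
      Complex.ofRealHom_eq_coe]
    refine Finset.sum_congr rfl fun k _ => ?_
    push_cast
    ring
  have h2 : ∀ i : Fin 4 → Fin 8,
      contract hkl H.vol (fun m => realFrame (i m)) (fun m => D (w' m)) =
        (2 ^ 4 * H.coeff.det) *
          (stack (k := 4) (l := 4) (Matrix.of fun m => Pi.single (i m) 1) (W * Bᵀ)).det := by
    intro i
    change ((2 : ℂ) ^ 4 * H.coeff.det) * stdVol _ = _
    rw [stdVol_apply]
    congr 1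
    congr 1
    ext m j
    revert m
    refine Fin.addCases (m := 4) (n := 4) (fun p => ?_) (fun p => ?_)
    · have e1 : stack (k := 4) (l := 4) (Matrix.of fun m => Pi.single (i m) 1) (W * Bᵀ)
          (Fin.castAdd 4 p) = Pi.single (i p) 1 := Fin.append_left _ _ _
      have e2 : Fin.append (fun m => realFrame (i m)) (fun m => D (w' m)) (Fin.castAdd 4 p) =
          realFrame (i p) := Fin.append_left _ _ _
      rw [e1]
      change ((realCoord (Fin.append (fun m => realFrame (i m)) (fun m => D (w' m))
        (Fin.castAdd 4 p)) j : ℝ) : ℂ) = _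
      rw [e2, realCoord_realFrame, Pi.single_apply, Pi.single_apply]
      split_ifs <;> simp
    · have e1 : stack (k := 4) (l := 4) (Matrix.of fun m => Pi.single (i m) 1) (W * Bᵀ)
          (Fin.natAdd 4 p) = (W * Bᵀ) p := Fin.append_right _ _ _
      have e2 : Fin.append (fun m => realFrame (i m)) (fun m => D (w' m)) (Fin.natAdd 4 p) =
          D (w' p) := Fin.append_right _ _ _
      rw [e1]
      change ((realCoord (Fin.append (fun m => realFrame (i m)) (fun m => D (w' m))
        (Fin.natAdd 4 p)) j : ℝ) : ℂ) = _
      rw [e2, realCoord_map]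
      change ((∑ k, realMatrix D j k * realCoord (w' p) k : ℝ) : ℂ) =
        ∑ k, (realCoord (w' p) k : ℂ) * (realMatrix D j k : ℂ)
      rw [Complex.ofReal_sum]
      exact Finset.sum_congr rfl fun k _ => by rw [Complex.ofReal_mul, mul_comm]
  have h3 : (stack (k := 4) (l := 4) N (W * Bᵀ)).det = (2⁻¹ : ℂ) ^ 4 *
      ((stack (k := 4) (l := 4) (splitMatrix.map (starRingEnd ℂ)) W).det * B.det) := by
    rw [hN, det_stack_smul, stack_mul, ← det_transpose B]
    exact congrArg _ (det_mul _ _)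
  have hBdet : B.det = ((realMatrix D).det : ℂ) :=
    (RingHom.map_det Complex.ofRealHom _).symm
  have h4 : starRingEnd ℂ (splitForm w') = (splitMatrix.map (starRingEnd ℂ) * Wᵀ).det := by
    rw [splitForm_eq_det, RingHom.map_det]
    congr 1
    ext a m
    simp [mul_apply, hW]
  have h5 := sum_minor_mul_det_stack (k := 4) (l := 4) N (W * Bᵀ)
  have hc := det_coeff_mul_det_realMatrix hD
  have h6 : ∀ i : Fin 4 → Fin 8, starRingEnd ℂ (ψ fun m => H.dualFrame (i m)) *
      contract hkl H.vol (fun m => realFrame (i m)) (fun m => D (w' m)) =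
      (starRingEnd ℂ f * (2 ^ 4 * H.coeff.det)) * ((N.submatrix id i).det *
          (stack (k := 4) (l := 4) (Matrix.of fun m => Pi.single (i m) 1) (W * Bᵀ)).det) := by
    intro i
    rw [h1, h2]
    ring
  rw [Sesq.star_apply, hψ, map_mul, h4, Finset.sum_congr rfl fun i _ => h6 i, ← Finset.mul_sum,
    h5, h3, det_stack_conj, hBdet]
  have h24 : ((Nat.factorial 4 : ℕ) : ℂ) ≠ 0 := by norm_num [Nat.factorial]
  have h2 : (2 : ℂ) ^ 4 * 2⁻¹ ^ 4 = 1 := by norm_num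
  calc _ = (((Nat.factorial 4 : ℕ) : ℂ)⁻¹ * ((Nat.factorial 4 : ℕ) : ℂ)) *
        ((2 : ℂ) ^ 4 * 2⁻¹ ^ 4) * (H.coeff.det * ((realMatrix D).det : ℂ)) *
        (16 / splitDet *
          (starRingEnd ℂ f * (splitMatrix.map (starRingEnd ℂ) * Wᵀ).det)) := by ring
    _ = _ := by rw [inv_mul_cancel₀ h24, h2, hc, one_mul, one_mul, one_mul]

end Orthonormal

end Star

section Coordinates

/-! ### Charts, transition maps and changes of coordinates -/

section Charts

open IsManifold Filter Topology

variable {M : Type*} [TopologicalSpace M] [ChartedSpace C4 M]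

lemma contDiffGroupoid_complex_le_real :
    contDiffGroupoid ω 𝓘(ℂ, C4) ≤ contDiffGroupoid ω 𝓘(ℝ, C4) := by
  intro e he
  have he' := mem_groupoid_of_pregroupoid.1 he
  exact mem_groupoid_of_pregroupoid.2
    ⟨ContDiffOn.restrict_scalars ℝ he'.1, ContDiffOn.restrict_scalars ℝ he'.2⟩

lemma isManifold_real [hM : IsManifold 𝓘(ℂ, C4) ω M] : IsManifold 𝓘(ℝ, C4) ω M where
  compatible he he' := contDiffGroupoid_complex_le_real (hM.compatible he he')

lemma mem_maximalAtlas_real {e : OpenPartialHomeomorph M C4}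
    (he : e ∈ maximalAtlas 𝓘(ℂ, C4) ω M) : e ∈ maximalAtlas 𝓘(ℝ, C4) ω M :=
  StructureGroupoid.maximalAtlas_mono contDiffGroupoid_complex_le_real he

lemma contDiffAt_transition {e e' : OpenPartialHomeomorph M C4}
    (he : e ∈ maximalAtlas 𝓘(ℂ, C4) ω M) (he' : e' ∈ maximalAtlas 𝓘(ℂ, C4) ω M) {u : C4}
    (hu : u ∈ e'.target) (hu' : e'.symm u ∈ e.source) : ContDiffAt ℂ ω (e ∘ e'.symm) u := by
  have h := compatible_of_mem_maximalAtlas he' he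
  rw [contDiffGroupoid, mem_groupoid_of_pregroupoid] at h
  have h1 : ContDiffOn ℂ ω (e ∘ e'.symm) (e'.symm ≫ₕ e).source := by
    have := h.1
    simpa [contDiffPregroupoid] using this
  exact h1.contDiffAt ((e'.symm ≫ₕ e).open_source.mem_nhds (by simp [hu, hu']))

lemma mfderiv_symm_complex {e : OpenPartialHomeomorph M C4}
    (he : e ∈ maximalAtlas 𝓘(ℂ, C4) ω M) {u : C4} (hu : u ∈ e.target) :
    mfderiv 𝓘(ℂ, C4) 𝓘(ℂ, C4) e.symm u = fderiv ℂ (chartAt C4 (e.symm u) ∘ e.symm) u := by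
  have h : MDifferentiableAt 𝓘(ℂ, C4) 𝓘(ℂ, C4) e.symm u :=
    (contMDiffAt_symm_of_mem_maximalAtlas he hu).mdifferentiableAt (by simp)
  refine h.mfderiv.trans ?_
  simp only [writtenInExtChartAt, mfld_simps, fderivWithin_univ]
  rfl

lemma mfderiv_symm_real {e : OpenPartialHomeomorph M C4}
    (he : e ∈ maximalAtlas 𝓘(ℂ, C4) ω M) {u : C4} (hu : u ∈ e.target) :
    mfderiv 𝓘(ℝ, C4) 𝓘(ℝ, C4) e.symm u = fderiv ℝ (chartAt C4 (e.symm u) ∘ e.symm) u := by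
  have h : MDifferentiableAt 𝓘(ℝ, C4) 𝓘(ℝ, C4) e.symm u :=
    (contMDiffAt_symm_of_mem_maximalAtlas (mem_maximalAtlas_real he) hu).mdifferentiableAt
      (by simp)
  refine h.mfderiv.trans ?_
  simp only [writtenInExtChartAt, mfld_simps, fderivWithin_univ]
  rfl

/-- The derivative at `u` of the inverse of the chart `e`, as a map into the tangent space at
`e.symm u`, which is identified with `ℂ⁴` by the preferred chart at that point. -/
def frameAt (e : OpenPartialHomeomorph M C4) (u : C4) : C4 →L[ℂ] C4 :=
  fderiv ℂ (chartAt C4 (e.symm u) ∘ e.symm) u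

lemma metricCoeff_apply
    (h : ∀ x : M, TangentSpace 𝓘(ℂ, C4) x →L[ℂ] TangentSpace 𝓘(ℂ, C4) x →L⋆[ℂ] ℂ)
    {e : OpenPartialHomeomorph M C4} (he : e ∈ maximalAtlas 𝓘(ℂ, C4) ω M) {u : C4}
    (hu : u ∈ e.target) (α β : Fin 4) :
    metricCoeff h e u α β = (show Sesq from h (e.symm u)) (frameAt e u (Pi.single α 1))
      (frameAt e u (Pi.single β 1)) := by
  rw [metricCoeff, Matrix.of_apply, mfderiv_symm_complex he hu]
  rfl

variable [IsManifold 𝓘(ℂ, C4) ω M]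

lemma contDiffAt_frame {e : OpenPartialHomeomorph M C4}
    (he : e ∈ maximalAtlas 𝓘(ℂ, C4) ω M) {u : C4} (hu : u ∈ e.target) :
    ContDiffAt ℂ ω (chartAt C4 (e.symm u) ∘ e.symm) u :=
  contDiffAt_transition (chart_mem_maximalAtlas _) he hu (mem_chart_source _ _)

lemma inChart_apply {k : ℕ} (η : DForm M k) {e : OpenPartialHomeomorph M C4}
    (he : e ∈ maximalAtlas 𝓘(ℂ, C4) ω M) {u : C4} (hu : u ∈ e.target) (v : Fin k → C4) :
    inChart η e u v = η (e.symm u) (fun m => frameAt e u (v m)) := by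
  have h : fderiv ℝ (chartAt C4 (e.symm u) ∘ e.symm) u = (frameAt e u).restrictScalars ℝ :=
    (((contDiffAt_frame he hu).differentiableAt (by simp)).fderiv_restrictScalars ℝ)
  rw [inChart, mfderiv_symm_real he hu, h]
  rfl

lemma frameAt_comp_transition {e e' : OpenPartialHomeomorph M C4}
    (he : e ∈ maximalAtlas 𝓘(ℂ, C4) ω M) (he' : e' ∈ maximalAtlas 𝓘(ℂ, C4) ω M) {u : C4}
    (hu : u ∈ e'.target) (hu' : e'.symm u ∈ e.source) :
    frameAt e' u = (frameAt e (e (e'.symm u))).comp (fderiv ℂ (e ∘ e'.symm) u) := by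
  have hmem : e (e'.symm u) ∈ e.target := e.map_source hu'
  have h1 := (contDiffAt_frame he hmem).differentiableAt (by simp)
  have h2 := (contDiffAt_transition he he' hu hu').differentiableAt (by simp)
  have h3 : (chartAt C4 (e'.symm u) ∘ e'.symm) =ᶠ[𝓝 u]
      (chartAt C4 (e.symm (e (e'.symm u))) ∘ e.symm) ∘ (e ∘ e'.symm) := by
    filter_upwards [(e'.symm ≫ₕ e).open_source.mem_nhds
      (show u ∈ (e'.symm ≫ₕ e).source by simp [hu, hu'])] with y hy
    simp only [OpenPartialHomeomorph.trans_source, OpenPartialHomeomorph.symm_source,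
      Set.mem_inter_iff, Set.mem_preimage] at hy
    simp [e.left_inv hy.2, e.left_inv hu']
  rw [frameAt, h3.fderiv_eq, fderiv_comp (g := chartAt C4 (e.symm (e (e'.symm u))) ∘ e.symm)
    (f := e ∘ e'.symm) u h1 h2]
  rfl

/-- Change of coordinates for differential forms. -/
lemma inChart_transition {k : ℕ} (η : DForm M k) {e e' : OpenPartialHomeomorph M C4}
    (he : e ∈ maximalAtlas 𝓘(ℂ, C4) ω M) (he' : e' ∈ maximalAtlas 𝓘(ℂ, C4) ω M) {u : C4}
    (hu : u ∈ e'.target) (hu' : e'.symm u ∈ e.source) :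
    inChart η e' u = (inChart η e (e (e'.symm u))).compContinuousLinearMap
      (fderiv ℝ (e ∘ e'.symm) u) := by
  have h : fderiv ℝ (e ∘ e'.symm) u = (fderiv ℂ (e ∘ e'.symm) u).restrictScalars ℝ :=
    ((contDiffAt_transition he he' hu hu').differentiableAt (by simp)).fderiv_restrictScalars ℝ
  ext v
  rw [inChart_apply η he' hu, h]
  change _ = inChart η e (e (e'.symm u)) (fun m => fderiv ℂ (e ∘ e'.symm) u (v m))
  rw [inChart_apply η he (e.map_source hu'), frameAt_comp_transition he he' hu hu']
  rw [e.left_inv hu']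
  rfl

/-! ### Exterior derivatives in arbitrary coordinates -/

/-- The exterior derivative may be tested in any holomorphic chart. -/
lemma extD_eq_zero {k : ℕ} {η : DForm M k} {e : OpenPartialHomeomorph M C4}
    (he : e ∈ maximalAtlas 𝓘(ℂ, C4) ω M) {x : M} (hx : x ∈ e.source)
    (hd : DifferentiableAt ℝ (inChart η e) (e x)) (h0 : extDeriv (inChart η e) (e x) = 0) :
    extD η x = 0 := by
  have hc : chartAt C4 x ∈ maximalAtlas 𝓘(ℂ, C4) ω M := chart_mem_maximalAtlas x
  set c := chartAt C4 x with hcdef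
  have hxc : x ∈ c.source := mem_chart_source _ _
  have hu : c x ∈ c.target := c.map_source hxc
  have hinv : c.symm (c x) = x := c.left_inv hxc
  have hu' : c.symm (c x) ∈ e.source := by rwa [hinv]
  have h1 : inChart η c =ᶠ[𝓝 (c x)] fun u => (inChart η e ((e ∘ c.symm) u)).compContinuousLinearMap
      (fderiv ℝ (e ∘ c.symm) u) := by
    filter_upwards [(c.symm ≫ₕ e).open_source.mem_nhds
      (show c x ∈ (c.symm ≫ₕ e).source by
        simpa using And.intro hu hu')] with y hy
    simp only [OpenPartialHomeomorph.trans_source, OpenPartialHomeomorph.symm_source,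
      Set.mem_inter_iff, Set.mem_preimage] at hy
    exact inChart_transition η he hc hy.1 hy.2
  have hval : (e ∘ c.symm) (c x) = e x := by simp [hinv]
  change extDeriv (inChart η c) (c x) = 0
  rw [h1.extDeriv_eq, extDeriv_pullback (r := ω) (by rwa [hval])
    ((contDiffAt_transition he hc hu hu').restrict_scalars ℝ) (by simp), hval, h0]
  rfl

end Charts

/-- The exterior derivative commutes with real-linear maps of the values. -/
lemma extDeriv_clm_comp {k : ℕ} (g : ℂ →L[ℝ] ℂ) {η : C4 → C4 [⋀^Fin k]→L[ℝ] ℂ} {u : C4}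
    (hd : DifferentiableAt ℝ η u) :
    extDeriv (fun y => g.compContinuousAlternatingMap (η y)) u =
      g.compContinuousAlternatingMap (extDeriv η u) := by
  have hd' : DifferentiableAt ℝ (fun y => g.compContinuousAlternatingMap (η y)) u :=
    (ContinuousLinearMap.compContinuousAlternatingMapCLM ℝ C4 ℂ ℂ (Fin k) g).differentiableAt.comp
      u hd
  have hap : ∀ w : Fin k → C4, DifferentiableAt ℝ (fun y => η y w) u := fun w =>
    (ContinuousAlternatingMap.apply ℝ C4 ℂ w).differentiableAt.comp u hd
  ext v
  rw [extDeriv_apply hd']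
  change _ = g (extDeriv η u v)
  rw [extDeriv_apply hd, map_sum]
  refine Finset.sum_congr rfl fun i _ => ?_
  change _ • fderiv ℝ (g ∘ fun y => η y (i.removeNth v)) u (v i) = _
  rw [fderiv_comp u g.differentiableAt (hap _), map_zsmul]
  simp

end Coordinates

section Closed

open IsManifold Filter Topology

/-! ### Split forms are closed -/

/-- `conj34` as a real-linear automorphism of `ℂ⁴`. -/
def conj34CLE : C4 ≃L[ℝ] C4 where
  toFun := conj34
  invFun := conj34
  map_add' v w := by ext a; fin_cases a <;> simp [conj34]
  map_smul' c v := by ext a; fin_cases a <;> simp [conj34]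
  left_inv v := by ext a; fin_cases a <;> simp [conj34]
  right_inv v := by ext a; fin_cases a <;> simp [conj34]
  continuous_toFun := by
    refine continuous_pi fun a => ?_
    fin_cases a <;> simp [conj34] <;> fun_prop
  continuous_invFun := by
    refine continuous_pi fun a => ?_
    fin_cases a <;> simp [conj34] <;> fun_prop

lemma conj34_conj34 (v : C4) : conj34 (conj34 v) = v := conj34CLE.left_inv v

/-- The complex-multilinear determinant form `dw¹ ∧ dw² ∧ dw³ ∧ dw⁴` on `ℂ⁴`. -/
def detForm : C4 [⋀^Fin 4]→L[ℂ] ℂ :=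
  { Matrix.detRowAlternating (R := ℂ) (n := Fin 4) with
    cont := by
      change Continuous fun v : Fin 4 → C4 => Matrix.det (Matrix.of v)
      exact Continuous.matrix_det (by fun_prop) }

lemma detForm_apply (v : Fin 4 → C4) : detForm v = Matrix.det (Matrix.of v) := rfl

lemma detForm_conj34 (v : Fin 4 → C4) : detForm (fun m => conj34 (v m)) = splitForm v := by
  rw [splitForm, ← Matrix.det_transpose]
  rfl

/-- A holomorphic form of top degree is closed. -/
lemma extDeriv_smul_detForm {f : C4 → ℂ} {w : C4} (hf : DifferentiableAt ℂ f w) :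
    extDeriv (fun y => f y • detForm.restrictScalars ℝ) w = 0 := by
  have hc : DifferentiableAt ℂ (fun y => f y • detForm) w := hf.smul_const _
  have hr : DifferentiableAt ℝ (fun y => f y • detForm.restrictScalars ℝ) w :=
    (hf.restrictScalars ℝ).smul_const _
  ext v
  have h : extDeriv (fun y => f y • detForm) w v = 0 := by
    refine AlternatingMap.map_linearDependent
      (extDeriv (fun y => f y • detForm) w).toAlternatingMap v fun hli => ?_
    -- Five vectors of `ℂ⁴` are linearly dependent.
    have := hli.fintype_card_le_finrank
    simp at this
  rw [extDeriv_apply hc] at h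
  rw [extDeriv_apply hr]
  refine Eq.trans (Finset.sum_congr rfl fun i _ => ?_) h
  -- Real and complex derivatives of the holomorphic coefficients agree.
  have h1 : DifferentiableAt ℂ (fun y => (f y • detForm) (i.removeNth v)) w :=
    hf.smul_const _
  have h2 := h1.fderiv_restrictScalars ℝ
  congr 1
  exact congrArg (fun L : C4 →L[ℝ] ℂ => L (v i)) h2

variable {M : Type*} [TopologicalSpace M] [ChartedSpace C4 M] {ψ : DForm M 4}

lemma isOpen_image_conj34 {s : Set C4} (hs : IsOpen s) : IsOpen (conj34 '' s) :=
  conj34CLE.toHomeomorph.isOpenMap s hs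

/-- In a coordinate system in which it splits, a form is differentiable and closed. -/
lemma IsSplitIn.closed {e : OpenPartialHomeomorph M C4} (h : IsSplitIn ψ e) {u : C4}
    (hu : u ∈ e.target) :
    DifferentiableAt ℝ (inChart ψ e) u ∧ extDeriv (inChart ψ e) u = 0 := by
  obtain ⟨f, hf, hψ⟩ := h
  have hfu : DifferentiableAt ℂ f (conj34 u) :=
    hf.differentiableAt ((isOpen_image_conj34 e.open_target).mem_nhds ⟨u, hu, rfl⟩)
  set η : C4 → C4 [⋀^Fin 4]→L[ℝ] ℂ := fun y => f y • detForm.restrictScalars ℝ with hη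
  have hηd : DifferentiableAt ℝ η (conj34CLE u) := (hfu.restrictScalars ℝ).smul_const _
  have heq : inChart ψ e =ᶠ[𝓝 u]
      fun y => (η (conj34CLE y)).compContinuousLinearMap (fderiv ℝ conj34CLE y) := by
    filter_upwards [e.open_target.mem_nhds hu] with y hy
    ext v
    rw [hψ y hy, ← detForm_conj34, conj34CLE.fderiv]
    rfl
  constructor
  · rw [heq.differentiableAt_iff]
    have : (fun y => (η (conj34CLE y)).compContinuousLinearMap (fderiv ℝ conj34CLE y)) =
        fun y => ContinuousAlternatingMap.compContinuousLinearMapCLM (F := ℂ) (ι := Fin 4)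
          (conj34CLE : C4 →L[ℝ] C4) (η (conj34CLE y)) := by
      funext y
      rw [conj34CLE.fderiv]
      rfl
    rw [this]
    exact (ContinuousLinearMap.differentiableAt _).comp u
      (hηd.comp u conj34CLE.differentiableAt)
  · rw [heq.extDeriv_eq, extDeriv_pullback (r := ω) hηd conj34CLE.contDiff.contDiffAt (by simp)]
    have : extDeriv η (conj34CLE u) = 0 := extDeriv_smul_detForm hfu
    rw [this]
    rfl

lemma extD_zero {k : ℕ} : extD (0 : DForm M k) = 0 := by
  funext x
  have h : inChart (0 : DForm M k) (chartAt C4 x) = fun _ => 0 := rfl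
  change extDeriv (inChart (0 : DForm M k) (chartAt C4 x)) _ = 0
  rw [h]
  ext v
  rw [extDeriv_apply (differentiableAt_const _)]
  simp

lemma Sesq.star_zero (H : Sesq) {k l : ℕ} (hkl : k + l = 8) :
    H.star hkl (0 : C4 [⋀^Fin k]→L[ℝ] ℂ) = 0 := by
  ext w
  rw [Sesq.star_apply]
  simp

lemma HermitianMetric.star_zero (h : HermitianMetric M) {k l : ℕ} (hkl : k + l = 8) :
    h.star hkl (0 : DForm M k) = 0 :=
  funext fun x => (h.at x).star_zero hkl

/-- A closed form whose Hodge star is closed is harmonic. -/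
lemma HermitianMetric.laplacian_eq_zero_of_closed (h : HermitianMetric M) {k l : ℕ}
    (hkl : k + l + 2 = 8) (η : DForm M (k + 1)) (hd : extD η = 0)
    (hds : extD (h.star (k := k + 1) (l := l + 1) (by omega) η) = 0) :
    h.laplacian hkl η = 0 := by
  rw [HermitianMetric.laplacian, HermitianMetric.codiff, HermitianMetric.codiff, hds, hd,
    star_zero, star_zero, extD_zero, star_zero, neg_zero, extD_zero, zero_add, neg_zero]

variable [IsManifold 𝓘(ℂ, C4) ω M]

lemma extD_eq_zero_of_isLocallySplit (hψ : IsLocallySplit ψ) : extD ψ = 0 := by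
  funext x
  obtain ⟨e, he, hx, hs⟩ := hψ x
  exact extD_eq_zero he hx (hs.closed (e.map_source hx)).1 (hs.closed (e.map_source hx)).2

/-! ### Harmonicity for adapted metrics -/

/-- For an adapted metric, `*ψ` is a universal multiple of the complex conjugate of `ψ`. -/
lemma HermitianMetric.IsAdapted.star_eq {h : HermitianMetric M} (hh : h.IsAdapted ψ)
    (hkl : 4 + 4 = 8) :
    h.star hkl ψ = fun x => (((16 / splitDet : ℂ) •
      (Complex.conjCLE : ℂ →L[ℝ] ℂ)).compContinuousAlternatingMap (ψ x)) := by
  funext x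
  obtain ⟨e, he, hx, ⟨f, -, hf⟩, hg⟩ := hh x
  obtain ⟨u, hu, rfl⟩ : ∃ u ∈ e.target, e.symm u = x := ⟨e x, e.map_source hx, e.left_inv hx⟩
  rw [e.right_inv hu] at hg
  ext w
  refine star_eq_smul_conj (H := h.at (e.symm u)) (D := frameAt e u) (f := f (conj34 u))
    (fun α β => ?_) (fun v => ?_) hkl w
  · have := congrFun (congrFun hg α) β
    rw [metricCoeff_apply h.form he hu, Matrix.one_apply] at this
    exact this
  · exact (inChart_apply ψ he hu v).symm.trans (hf u hu v)

theorem HermitianMetric.IsAdapted.laplacian_eq_zero {h : HermitianMetric M}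
    (hh : h.IsAdapted ψ) : h.laplacian (k := 3) (l := 3) rfl ψ = 0 := by
  have hloc : IsLocallySplit ψ := fun x => by
    obtain ⟨e, he, hx, hs, -⟩ := hh x
    exact ⟨e, he, hx, hs⟩
  have hd := extD_eq_zero_of_isLocallySplit hloc
  have hds : extD (h.star (k := 4) (l := 4) rfl ψ) = 0 := by
    rw [hh.star_eq]
    funext x
    obtain ⟨e, he, hx, hs, -⟩ := hh x
    obtain ⟨h1, h2⟩ := hs.closed (e.map_source hx)
    set g : ℂ →L[ℝ] ℂ := (16 / splitDet : ℂ) • (Complex.conjCLE : ℂ →L[ℝ] ℂ)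
    have h3 : inChart (fun x => g.compContinuousAlternatingMap (ψ x) : DForm M 4) e =
        fun u => g.compContinuousAlternatingMap (inChart ψ e u) := rfl
    refine extD_eq_zero he hx ?_ ?_
    · rw [h3]
      exact (ContinuousLinearMap.compContinuousAlternatingMapCLM
        ℝ C4 ℂ ℂ (Fin 4) g).differentiableAt.comp _ h1
    · rw [h3, extDeriv_clm_comp g h1, h2]
      ext v
      simp
  exact h.laplacian_eq_zero_of_closed (k := 3) (l := 3) rfl ψ hd hds

end Closed

section Splitting

open IsManifold Filter Topology

/-! ### The involution commuting with the splitting -/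

/-- The signs of the two blocks of coordinates. -/
def blockSign : Fin 4 → ℂ := ![1, 1, -1, -1]

lemma blockSign_mul_self (a : Fin 4) : blockSign a * blockSign a = 1 := by
  fin_cases a <;> simp [blockSign]

lemma conj_blockSign (a : Fin 4) : starRingEnd ℂ (blockSign a) = blockSign a := by
  fin_cases a <;> simp [blockSign]

/-- The involution `(z¹, z², z³, z⁴) ↦ (z¹, z², -z³, -z⁴)`. A linear map commutes with it exactly
when it preserves the splitting `ℂ⁴ = ℂ² ⊕ ℂ²`. -/
def signMap : C4 →L[ℂ] C4 :=
  ContinuousLinearMap.pi fun a => blockSign a • ContinuousLinearMap.proj a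

@[simp] lemma signMap_apply (v : C4) (a : Fin 4) : signMap v a = blockSign a * v a := rfl

/-- Multiplication by scalars for the complex structure that `conj34` transports to `ℂ⁴`. -/
lemma conj34_smul (c : ℂ) (v : C4) :
    conj34 (c • v) = (c.re : ℂ) • conj34 v + (c.im * Complex.I : ℂ) • signMap (conj34 v) := by
  ext a
  fin_cases a <;> simp [conj34, blockSign] <;> apply Complex.ext <;> simp <;> ring

/-- A linear map preserving the splitting becomes, in the coordinates `(z¹, z², z̄³, z̄⁴)`, a
complex-linear map. -/
def conjugated (P : C4 →L[ℂ] C4) (hP : ∀ v, P (signMap v) = signMap (P v)) : C4 →L[ℂ] C4 where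
  toFun v := conj34 (P (conj34 v))
  map_add' v w := by
    have h : ∀ x y, conj34 (x + y) = conj34 x + conj34 y := map_add conj34CLE
    rw [h, map_add, h]
  map_smul' c v := by
    have h : ∀ x y, conj34 (x + y) = conj34 x + conj34 y := map_add conj34CLE
    have h1 : P (conj34 (c • v)) = conj34 (c • conj34 (P (conj34 v))) := by
      rw [conj34_smul, conj34_smul, map_add, map_smul, map_smul, hP, conj34_conj34]
    rw [h1, conj34_conj34]
    rfl
  cont := conj34CLE.continuous.comp (P.continuous.comp conj34CLE.continuous)

lemma detForm_map (Q : C4 →L[ℂ] C4) (v : Fin 4 → C4) :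
    detForm (fun m => Q (v m)) = LinearMap.det Q.toLinearMap * detForm v := by
  have h := (Pi.basisFun ℂ (Fin 4)).det_comp Q.toLinearMap v
  rw [Pi.basisFun_det] at h
  exact h

/-- Cramer's rule: a vector that can be put in every slot of a basis to give determinant zero
vanishes. -/
lemma eq_zero_of_detForm_update {b : Fin 4 → C4} (hb : detForm b ≠ 0) {d : C4}
    (h : ∀ i, detForm (Function.update b i d) = 0) : d = 0 := by
  have hcr : Matrix.cramer (Matrix.of b).transpose d = 0 := by
    ext i
    rw [Matrix.cramer_transpose_apply, Matrix.updateRow]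
    have hi := h i
    rw [detForm_apply] at hi
    exact hi
  rw [detForm_apply] at hb
  have h1 := Matrix.mulVec_cramer (Matrix.of b).transpose d
  rw [hcr, Matrix.mulVec_zero, Matrix.det_transpose] at h1
  exact (smul_eq_zero.1 h1.symm).resolve_left hb

/-- A complex-linear map that multiplies `dz¹ ∧ dz² ∧ dz̄³ ∧ dz̄⁴` by a non-zero scalar preserves
the splitting. -/
lemma commute_signMap_of_splitForm {L : C4 →L[ℂ] C4} {c : ℂ} (hc : c ≠ 0)
    (hL : ∀ v : Fin 4 → C4, splitForm (fun m => L (v m)) = c * splitForm v) (v : C4) :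
    L (signMap v) = signMap (L v) := by
  -- `K` is `L` in the variables `(z¹, z², z̄³, z̄⁴)`. It scales the complex determinant, which forces
  -- it to be complex linear; for the original variables this says that `L` commutes with
  -- `signMap`.
  set K : C4 →L[ℝ] C4 := (conj34CLE : C4 →L[ℝ] C4) ∘L (L.restrictScalars ℝ) ∘L
    (conj34CLE : C4 →L[ℝ] C4) with hKdef
  have hKa : ∀ w, K w = conj34 (L (conj34 w)) := fun w => rfl
  have hK : ∀ w : Fin 4 → C4, detForm (fun m => K (w m)) = c * detForm w := by
    intro w
    have h := hL fun m => conj34 (w m)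
    rw [← detForm_conj34, ← detForm_conj34] at h
    simp only [conj34_conj34] at h
    exact h
  set b : Fin 4 → C4 := fun j => Pi.single j 1 with hb
  have hdet : detForm (fun m => K (b m)) ≠ 0 := by
    rw [hK]
    refine mul_ne_zero hc ?_
    have : detForm b = Matrix.det (1 : Matrix (Fin 4) (Fin 4) ℂ) := by
      change Matrix.det (Matrix.of b) = _
      congr 1
      ext i j
      simp [hb, Matrix.one_apply, Pi.single_apply, eq_comm]
    rw [this, Matrix.det_one]
    exact one_ne_zero
  have hKI : ∀ w, K (Complex.I • w) = Complex.I • K w := by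
    intro w
    set d := K (Complex.I • w) - Complex.I • K w with hd
    have hslot : ∀ i, detForm (Function.update (fun m => K (b m)) i d) = 0 := by
      intro i
      have hupd : ∀ x, Function.update (fun m => K (b m)) i (K x) =
          fun m => K (Function.update b i x m) := by
        intro x
        ext1 m
        by_cases hm : m = i
        · subst hm; simp
        · simp [hm]
      rw [hd, ContinuousAlternatingMap.map_update_sub, ContinuousAlternatingMap.map_update_smul,
        hupd, hupd, hK, hK, ContinuousAlternatingMap.map_update_smul]
      simp only [smul_eq_mul]
      ring
    exact sub_eq_zero.1 (eq_zero_of_detForm_update hdet hslot)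
  have hI : ∀ w : C4, Complex.I • signMap w = conj34 (Complex.I • conj34 w) := by
    intro w
    rw [conj34_smul, conj34_conj34]
    simp
  have h : Complex.I • L (signMap v) = Complex.I • signMap (L v) := by
    have h1 := hKI (conj34 v)
    rw [hKa, hKa, conj34_conj34] at h1
    rw [← map_smul, hI, hI, ← h1, conj34_conj34]
  exact smul_right_injective _ Complex.I_ne_zero h

/-! ### Inverse square roots of positive matrices -/

section Root

open scoped ComplexOrder MatrixOrder Matrix.Norms.L2Operator

/-- A positive definite matrix has a Hermitian inverse square root, and it commutes with
everything that the matrix commutes with. -/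
lemma exists_invSqrt {g : Matrix (Fin 4) (Fin 4) ℂ} (hg : g.PosDef) :
    ∃ R : Matrix (Fin 4) (Fin 4) ℂ, IsUnit R ∧ R.IsHermitian ∧ R * g * R = 1 ∧
      ∀ T, Commute g T → Commute R T := by
  have hg0 : 0 ≤ g := hg.posSemidef.nonneg
  set Q := CFC.sqrt g with hQ
  have hQQ : Q * Q = g := CFC.sqrt_mul_sqrt_self g hg0
  have hQh : Q.IsHermitian := (Matrix.nonneg_iff_posSemidef.1 (CFC.sqrt_nonneg g)).isHermitian
  have hQu : IsUnit Q := by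
    rw [Matrix.isUnit_iff_isUnit_det, isUnit_iff_ne_zero]
    intro h
    have := hg.det_pos.ne'
    rw [← hQQ, Matrix.det_mul, h] at this
    simp at this
  have hQd : IsUnit Q.det := (Matrix.isUnit_iff_isUnit_det _).1 hQu
  have hcomm : ∀ T, Commute g T → Commute Q T := fun T hT => hT.cfcₙ_nnreal _
  refine ⟨Q⁻¹, ?_, hQh.inv, ?_, fun T hT => ?_⟩
  · rwa [Matrix.isUnit_nonsing_inv_iff]
  · rw [← hQQ, ← Matrix.mul_assoc, Matrix.nonsing_inv_mul _ hQd, Matrix.one_mul,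
      Matrix.mul_nonsing_inv _ hQd]
  · have h := hcomm T hT
    change Q⁻¹ * T = T * Q⁻¹
    calc Q⁻¹ * T = Q⁻¹ * (T * Q) * Q⁻¹ := by
          rw [Matrix.mul_assoc, Matrix.mul_assoc, Matrix.mul_nonsing_inv _ hQd, Matrix.mul_one]
      _ = T * Q⁻¹ := by
          rw [← h.eq, ← Matrix.mul_assoc, Matrix.nonsing_inv_mul _ hQd, Matrix.one_mul]

end Root

end Splitting

section LinearChange

open IsManifold Filter Topology

variable {M : Type*} [TopologicalSpace M]

/-! ### Linear changes of coordinates -/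

/-- The coordinate system `P⁻¹ ∘ e`. -/
def linChart (e : OpenPartialHomeomorph M C4) (P : C4 ≃L[ℂ] C4) : OpenPartialHomeomorph M C4 :=
  e.transHomeomorph P.symm.toHomeomorph

section LinChart

variable {e : OpenPartialHomeomorph M C4} {P : C4 ≃L[ℂ] C4}

@[simp] lemma linChart_source : (linChart e P).source = e.source := rfl

@[simp] lemma linChart_apply (x : M) : linChart e P x = P.symm (e x) := rfl

@[simp] lemma linChart_symm_apply (u : C4) : (linChart e P).symm u = e.symm (P u) := rfl

lemma mem_target_linChart {u : C4} : u ∈ (linChart e P).target ↔ P u ∈ e.target := Iff.rfl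

variable [ChartedSpace C4 M] [IsManifold 𝓘(ℂ, C4) ω M]

lemma linChart_mem_maximalAtlas (he : e ∈ maximalAtlas 𝓘(ℂ, C4) ω M) :
    linChart e P ∈ maximalAtlas 𝓘(ℂ, C4) ω M := by
  refine OpenPartialHomeomorph.mem_maximalAtlas_of_contMDiffOn (M := M) (I := 𝓘(ℂ, C4)) (n := ω)
    (φ := linChart e P) ?_ ?_
  · exact (P.symm.contDiff.contMDiff.comp_contMDiffOn (contMDiffOn_of_mem_maximalAtlas he))
  · exact (contMDiffOn_symm_of_mem_maximalAtlas he).comp P.contDiff.contMDiff.contMDiffOn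
      fun u hu => hu

lemma frameAt_linChart (he : e ∈ maximalAtlas 𝓘(ℂ, C4) ω M) {u : C4}
    (hu : P u ∈ e.target) (v : C4) : frameAt (linChart e P) u v = frameAt e (P u) (P v) := by
  have hu' : (linChart e P).symm u ∈ e.source := e.map_target hu
  have heq : e ∘ (linChart e P).symm =ᶠ[𝓝 u] P := by
    filter_upwards [(e.open_target.preimage P.continuous).mem_nhds hu] with y hy
    exact e.right_inv hy
  rw [frameAt_comp_transition he (linChart_mem_maximalAtlas he) hu hu', heq.fderiv_eq, P.fderiv]
  simp [e.right_inv hu]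

lemma inChart_linChart {k : ℕ} (η : DForm M k) (he : e ∈ maximalAtlas 𝓘(ℂ, C4) ω M) {u : C4}
    (hu : P u ∈ e.target) (v : Fin k → C4) :
    inChart η (linChart e P) u v = inChart η e (P u) (fun m => P (v m)) := by
  rw [inChart_apply η (linChart_mem_maximalAtlas he) hu, inChart_apply η he hu]
  simp only [frameAt_linChart he hu]
  rfl

/-- A linear change of coordinates preserving the splitting of `ℂ⁴` keeps a form split. -/
lemma IsSplitIn.linChart {ψ : DForm M 4} (he : e ∈ maximalAtlas 𝓘(ℂ, C4) ω M)
    (hs : IsSplitIn ψ e) (hP : ∀ v, P (signMap v) = signMap (P v)) :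
    IsSplitIn ψ (linChart e P) := by
  obtain ⟨f, hf, hψ⟩ := hs
  set Q : C4 →L[ℂ] C4 := conjugated P hP with hQ
  have hQa : ∀ v, Q (conj34 v) = conj34 (P v) := fun v => by
    change conj34 (P (conj34 (conj34 v))) = _
    rw [conj34_conj34]
  refine ⟨fun w => LinearMap.det Q.toLinearMap * f (Q w), ?_, fun u hu v => ?_⟩
  · refine (hf.comp Q.differentiable.differentiableOn ?_).const_mul _
    rintro _ ⟨u, hu, rfl⟩
    exact ⟨P u, hu, (hQa u).symm⟩
  · rw [inChart_linChart ψ he hu, hψ (P u) hu, ← detForm_conj34, ← detForm_conj34]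
    beta_reduce
    rw [hQa]
    simp only [← hQa]
    rw [detForm_map]
    ring

end LinChart

/-! ### The differential of a chart -/

variable [ChartedSpace C4 M]

section Coframe

/-- The derivative at `x` of the chart `e`, as a map on the tangent space at `x`. -/
def coframeAt (e : OpenPartialHomeomorph M C4) (x : M) : C4 →L[ℂ] C4 :=
  fderiv ℂ (e ∘ (chartAt C4 x).symm) (chartAt C4 x x)

variable [IsManifold 𝓘(ℂ, C4) ω M] {e e' : OpenPartialHomeomorph M C4}

lemma coframeAt_frameAt (he : e ∈ maximalAtlas 𝓘(ℂ, C4) ω M)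
    (he' : e' ∈ maximalAtlas 𝓘(ℂ, C4) ω M) {u : C4} (hu : u ∈ e'.target)
    (hu' : e'.symm u ∈ e.source) (v : C4) :
    coframeAt e (e'.symm u) (frameAt e' u v) = fderiv ℂ (e ∘ e'.symm) u v := by
  set x := e'.symm u with hx
  set c := chartAt C4 x with hc
  have hcm : c ∈ maximalAtlas 𝓘(ℂ, C4) ω M := chart_mem_maximalAtlas x
  have hxc : x ∈ c.source := mem_chart_source _ _
  have h1 : DifferentiableAt ℂ (e ∘ c.symm) (c x) :=
    (contDiffAt_transition he hcm (c.map_source hxc)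
      (by rwa [c.left_inv hxc])).differentiableAt (by simp)
  have h2 : DifferentiableAt ℂ (c ∘ e'.symm) u :=
    (contDiffAt_transition hcm he' hu hxc).differentiableAt (by simp)
  have h3 : e ∘ e'.symm =ᶠ[𝓝 u] (e ∘ c.symm) ∘ (c ∘ e'.symm) := by
    filter_upwards [(e'.symm ≫ₕ c).open_source.mem_nhds
      (show u ∈ (e'.symm ≫ₕ c).source by simpa using And.intro hu hxc)] with y hy
    simp only [OpenPartialHomeomorph.trans_source, OpenPartialHomeomorph.symm_source,
      Set.mem_inter_iff, Set.mem_preimage] at hy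
    simp [c.left_inv hy.2]
  rw [h3.fderiv_eq, fderiv_comp (g := e ∘ c.symm) (f := c ∘ e'.symm) u h1 h2]
  rfl

lemma coframeAt_frameAt_self (he : e ∈ maximalAtlas 𝓘(ℂ, C4) ω M) {u : C4} (hu : u ∈ e.target)
    (v : C4) : coframeAt e (e.symm u) (frameAt e u v) = v := by
  have h : e ∘ e.symm =ᶠ[𝓝 u] id := by
    filter_upwards [e.open_target.mem_nhds hu] with y hy
    exact e.right_inv hy
  rw [coframeAt_frameAt he he hu (e.map_target hu), h.fderiv_eq, fderiv_id]
  rfl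

lemma coframeAt_injective (he : e ∈ maximalAtlas 𝓘(ℂ, C4) ω M) {x : M} (hx : x ∈ e.source) :
    Function.Injective (coframeAt e x) := by
  have hs : Function.Surjective (coframeAt e x).toLinearMap := fun v =>
    ⟨frameAt e (e x) v, by
      have := coframeAt_frameAt_self he (e.map_source hx) v
      rwa [e.left_inv hx] at this⟩
  exact LinearMap.injective_iff_surjective.2 hs

lemma frameAt_injective (he : e ∈ maximalAtlas 𝓘(ℂ, C4) ω M) {u : C4} (hu : u ∈ e.target) :
    Function.Injective (frameAt e u) :=
  Function.LeftInverse.injective (coframeAt_frameAt_self he hu)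

end Coframe

/-- Transition maps between split coordinate systems preserve, at each point where the form does
not vanish, the splitting of `ℂ⁴`. -/
lemma fderiv_transition_signMap_of_ne_zero [IsManifold 𝓘(ℂ, C4) ω M] {ψ : DForm M 4}
    {e e' : OpenPartialHomeomorph M C4}
    (he : e ∈ maximalAtlas 𝓘(ℂ, C4) ω M) (he' : e' ∈ maximalAtlas 𝓘(ℂ, C4) ω M)
    (hs : IsSplitIn ψ e) {u : C4} (hu : u ∈ e'.target) (hu' : e'.symm u ∈ e.source) {c : ℂ}
    (hc : c ≠ 0) (hψ : ∀ v : Fin 4 → C4, inChart ψ e' u v = c * splitForm v) (v : C4) :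
    fderiv ℂ (e ∘ e'.symm) u (signMap v) = signMap (fderiv ℂ (e ∘ e'.symm) u v) := by
  obtain ⟨f, -, hf⟩ := hs
  have h : ∀ v : Fin 4 → C4, c * splitForm v = f (conj34 (e (e'.symm u))) *
      splitForm (fun m => fderiv ℂ (e ∘ e'.symm) u (v m)) := by
    intro v
    rw [← hψ, ← hf _ (e.map_source hu'), inChart_apply ψ he' hu,
      inChart_apply ψ he (e.map_source hu'), frameAt_comp_transition he he' hu hu',
      e.left_inv hu']
    rfl
  have hb : splitForm (fun j => conj34 (Pi.single j 1)) = 1 := by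
    rw [← detForm_conj34, detForm_apply]
    simp only [conj34_conj34]
    rw [← Matrix.det_one (n := Fin 4)]
    congr 1
    ext i j
    simp [Matrix.one_apply, Pi.single_apply, eq_comm]
  have hf0 : f (conj34 (e (e'.symm u))) ≠ 0 := by
    intro h0
    have := h fun j => conj34 (Pi.single j 1)
    rw [hb, h0, zero_mul, mul_one] at this
    exact hc this
  refine commute_signMap_of_splitForm (c := (f (conj34 (e (e'.symm u))))⁻¹ * c)
    (mul_ne_zero (inv_ne_zero hf0) hc) (fun v => ?_) v
  rw [mul_assoc, h v, inv_mul_cancel_left₀ hf0]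

/-- If a split form is not identically zero near a point, every transition map to split
coordinates preserves the splitting of `ℂ⁴` there, by continuity. -/
lemma fderiv_transition_signMap [IsManifold 𝓘(ℂ, C4) ω M] {ψ : DForm M 4}
    {e e' : OpenPartialHomeomorph M C4}
    (he : e ∈ maximalAtlas 𝓘(ℂ, C4) ω M) (he' : e' ∈ maximalAtlas 𝓘(ℂ, C4) ω M)
    (hs : IsSplitIn ψ e) {u : C4} (hu : u ∈ e'.target) (hu' : e'.symm u ∈ e.source) {f : C4 → ℂ}
    (hf : ∃ᶠ y in 𝓝 u, f y ≠ 0)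
    (hψ : ∀ y ∈ e'.target, ∀ v : Fin 4 → C4, inChart ψ e' y v = f y * splitForm v) (v : C4) :
    fderiv ℂ (e ∘ e'.symm) u (signMap v) = signMap (fderiv ℂ (e ∘ e'.symm) u v) := by
  have hcont : ContinuousAt (fderiv ℂ (e ∘ e'.symm)) u :=
    ((contDiffAt_transition he he' hu hu').fderiv_right (m := 0) (by simp)).continuousAt
  have hfreq : ∃ᶠ y in 𝓝 u, fderiv ℂ (e ∘ e'.symm) y ∈
      {L : C4 →L[ℂ] C4 | L (signMap v) = signMap (L v)} := by
    refine (hf.and_eventually ((e'.symm ≫ₕ e).open_source.mem_nhds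
      (show u ∈ (e'.symm ≫ₕ e).source by simpa using And.intro hu hu'))).mono ?_
    rintro y ⟨hy0, hy⟩
    exact fderiv_transition_signMap_of_ne_zero he he' hs hy.1 hy.2 hy0 (hψ y hy.1) v
  have hclosed : IsClosed {L : C4 →L[ℂ] C4 | L (signMap v) = signMap (L v)} :=
    isClosed_eq (by fun_prop) (by fun_prop)
  exact hclosed.mem_of_frequently_of_tendsto hfreq hcont

end LinearChange

section Existence

open IsManifold Filter Topology

variable {M : Type*} [TopologicalSpace M] [ChartedSpace C4 M]

/-! ### Metrics glued from coordinate systems -/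

/-- The pullback `∑ L^* (dz^a) ⊗ conj (L^* (dz^a))` of the standard Hermitian form on `ℂ⁴`. -/
def pullSesq (L : C4 →L[ℂ] C4) : Sesq :=
  ∑ a, ((ContinuousLinearMap.proj a).comp L).smulRight
    (((starL ℂ : ℂ ≃L⋆[ℂ] ℂ) : ℂ →L⋆[ℂ] ℂ).comp ((ContinuousLinearMap.proj a).comp L))

lemma pullSesq_apply (L : C4 →L[ℂ] C4) (v w : C4) :
    pullSesq L v w = ∑ a, L v a * starRingEnd ℂ (L w a) := by
  simp [pullSesq]

lemma pullSesq_signMap (L : C4 →L[ℂ] C4) (hL : ∀ v, L (signMap v) = signMap (L v)) (v w : C4) :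
    pullSesq L (signMap v) (signMap w) = pullSesq L v w := by
  simp only [pullSesq_apply, hL, signMap_apply, map_mul, conj_blockSign]
  refine Finset.sum_congr rfl fun a _ => ?_
  linear_combination (L v a * starRingEnd ℂ (L w a)) * blockSign_mul_self a

section Glue

variable {ι : Type*} [Fintype ι]

/-- The combination, with weights `ρ i`, of the flat metrics of the coordinate systems `e i`. -/
def gluedForm (e : ι → OpenPartialHomeomorph M C4) (ρ : ι → M → ℝ) (x : M) : Sesq :=
  ∑ i, ((ρ i x : ℝ) : ℂ) • pullSesq (coframeAt (e i) x)

lemma gluedForm_apply (e : ι → OpenPartialHomeomorph M C4) (ρ : ι → M → ℝ) (x : M) (v w : C4) :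
    gluedForm e ρ x v w = ∑ i, (ρ i x : ℂ) * pullSesq (coframeAt (e i) x) v w := by
  simp [gluedForm]

lemma gluedForm_conj_symm (e : ι → OpenPartialHomeomorph M C4) (ρ : ι → M → ℝ) (x : M)
    (v w : C4) : gluedForm e ρ x w v = starRingEnd ℂ (gluedForm e ρ x v w) := by
  simp only [gluedForm_apply, pullSesq_apply, map_sum, map_mul, Complex.conj_ofReal,
    Complex.conj_conj]
  refine Finset.sum_congr rfl fun i _ => ?_
  congr 1
  exact Finset.sum_congr rfl fun a _ => mul_comm _ _

variable [IsManifold 𝓘(ℂ, C4) ω M] {e : ι → OpenPartialHomeomorph M C4} {ρ : ι → M → ℝ}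

/-- In a coordinate system, the components of the flat metric of another one are smooth. -/
lemma contDiffAt_pullSesq_coframeAt {c e' : OpenPartialHomeomorph M C4}
    (hc : c ∈ maximalAtlas 𝓘(ℂ, C4) ω M) (he' : e' ∈ maximalAtlas 𝓘(ℂ, C4) ω M) {u : C4}
    (hu : u ∈ e'.target) (hu' : e'.symm u ∈ c.source) (v w : C4) :
    ContDiffAt ℝ ∞ (fun y => pullSesq (coframeAt c (e'.symm y)) (frameAt e' y v)
      (frameAt e' y w)) u := by
  have heq : (fun y => pullSesq (coframeAt c (e'.symm y)) (frameAt e' y v) (frameAt e' y w))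
      =ᶠ[𝓝 u] fun y => ∑ a, fderiv ℂ (c ∘ e'.symm) y v a *
        Complex.conjCLE (fderiv ℂ (c ∘ e'.symm) y w a) := by
    filter_upwards [(e'.symm ≫ₕ c).open_source.mem_nhds
      (show u ∈ (e'.symm ≫ₕ c).source by simpa using And.intro hu hu')] with y hy
    simp only [OpenPartialHomeomorph.trans_source, OpenPartialHomeomorph.symm_source,
      Set.mem_inter_iff, Set.mem_preimage] at hy
    rw [pullSesq_apply, coframeAt_frameAt hc he' hy.1 hy.2, coframeAt_frameAt hc he' hy.1 hy.2]
    rfl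
  refine ContDiffAt.congr_of_eventuallyEq ?_ heq
  have hd : ContDiffAt ℂ ∞ (fderiv ℂ (c ∘ e'.symm)) u :=
    (contDiffAt_transition hc he' hu hu').fderiv_right (by simp)
  have hva : ∀ (v : C4) (a : Fin 4),
      ContDiffAt ℝ ∞ (fun y => fderiv ℂ (c ∘ e'.symm) y v a) u := fun v a =>
    (contDiffAt_pi.1 (hd.clm_apply contDiffAt_const) a).restrict_scalars ℝ
  exact ContDiffAt.sum fun a _ =>
    (hva v a).mul (Complex.conjCLE.contDiff.contDiffAt.comp u (hva w a))

lemma gluedForm_pos (he : ∀ i, e i ∈ maximalAtlas 𝓘(ℂ, C4) ω M) (hρ0 : ∀ i x, 0 ≤ ρ i x)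
    (hsupp : ∀ i, tsupport (ρ i) ⊆ (e i).source) (hpos : ∀ x, ∃ i, 0 < ρ i x) (x : M) (v : C4)
    (hv : v ≠ 0) : 0 < (gluedForm e ρ x v v).re := by
  have hre : (gluedForm e ρ x v v).re =
      ∑ i, ρ i x * ∑ a, Complex.normSq (coframeAt (e i) x v a) := by
    rw [gluedForm_apply, Complex.re_sum]
    refine Finset.sum_congr rfl fun i _ => ?_
    rw [Complex.re_ofReal_mul, pullSesq_apply, Complex.re_sum]
    congr 1
    refine Finset.sum_congr rfl fun a _ => ?_
    rw [Complex.mul_conj, Complex.ofReal_re]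
  rw [hre]
  have hnn : ∀ i, 0 ≤ ∑ a, Complex.normSq (coframeAt (e i) x v a) := fun i =>
    Finset.sum_nonneg fun a _ => Complex.normSq_nonneg _
  obtain ⟨i, hi⟩ := hpos x
  refine Finset.sum_pos' (fun j _ => mul_nonneg (hρ0 j x) (hnn j))
    ⟨i, Finset.mem_univ _, mul_pos hi ?_⟩
  have hx : x ∈ (e i).source := hsupp i (subset_tsupport _ hi.ne')
  have hne : coframeAt (e i) x v ≠ 0 := fun h =>
    hv (coframeAt_injective (he i) hx (h.trans (map_zero _).symm))
  obtain ⟨a, ha⟩ := Function.ne_iff.1 hne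
  exact Finset.sum_pos' (fun b _ => Complex.normSq_nonneg _)
    ⟨a, Finset.mem_univ _, Complex.normSq_pos.2 ha⟩

/-- The Hermitian metric glued from the flat metrics of the coordinate systems `e i`, with
non-negative weights supported in their domains. -/
def gluedMetric (he : ∀ i, e i ∈ maximalAtlas 𝓘(ℂ, C4) ω M)
    (hρ : ∀ i, ContMDiff 𝓘(ℝ, C4) 𝓘(ℝ, ℝ) ∞ (ρ i)) (hρ0 : ∀ i x, 0 ≤ ρ i x)
    (hsupp : ∀ i, tsupport (ρ i) ⊆ (e i).source) (hpos : ∀ x, ∃ i, 0 < ρ i x) :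
    HermitianMetric M where
  form x := gluedForm e ρ x
  conj_symm x := gluedForm_conj_symm e ρ x
  pos x := gluedForm_pos he hρ0 hsupp hpos x
  smooth e' he' α β := by
    have hform : ∀ u ∈ e'.target, metricCoeff (M := M) (fun x => gluedForm e ρ x) e' u α β =
        ∑ i, Complex.ofRealCLM (ρ i (e'.symm u)) * pullSesq (coframeAt (e i) (e'.symm u))
          (frameAt e' u (Pi.single α 1)) (frameAt e' u (Pi.single β 1)) := fun u hu =>
      (metricCoeff_apply _ he' hu α β).trans (gluedForm_apply e ρ _ _ _)
    refine ContDiffOn.congr (ContDiffOn.sum fun i _ => ?_) hform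
    intro u hu
    refine ContDiffAt.contDiffWithinAt ?_
    by_cases hx : e'.symm u ∈ (e i).source
    · have h1 : ContDiffAt ℝ ∞ (fun y => ρ i (e'.symm y)) u := by
        have h2 : ContMDiffAt 𝓘(ℝ, C4) 𝓘(ℝ, C4) ∞ e'.symm u :=
          (contMDiffAt_symm_of_mem_maximalAtlas (mem_maximalAtlas_real he') hu).of_le (by simp)
        exact contMDiffAt_iff_contDiffAt.1 ((hρ i).contMDiffAt.comp u h2)
      exact (Complex.ofRealCLM.contDiff.contDiffAt.comp u h1).mul
        (contDiffAt_pullSesq_coframeAt (he i) he' hu hx _ _)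
    · have hx' : e'.symm u ∉ tsupport (ρ i) := fun h => hx (hsupp i h)
      have hz : ∀ᶠ y in 𝓝 u, ρ i (e'.symm y) = 0 :=
        (e'.continuousAt_symm hu).eventually (notMem_tsupport_iff_eventuallyEq.1 hx')
      refine ContDiffAt.congr_of_eventuallyEq (contDiffAt_const (c := 0)) ?_
      filter_upwards [hz] with y hy
      simp [hy]

end Glue

/-! ### Orthonormal coordinates at a point -/

section OrthonormalChart

open scoped ComplexOrder

variable [IsManifold 𝓘(ℂ, C4) ω M]

/-- A linear change of coordinates makes a metric standard at a given point; if the metric is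
block diagonal there, the change can be taken block diagonal. -/
lemma exists_linChart_metricCoeff_eq_one (h : HermitianMetric M) {e : OpenPartialHomeomorph M C4}
    (he : e ∈ maximalAtlas 𝓘(ℂ, C4) ω M) {u : C4} (hu : u ∈ e.target) :
    ∃ P : C4 ≃L[ℂ] C4,
      metricCoeff h.form (linChart e P) (linChart e P (e.symm u)) = 1 ∧
      ((∀ v w, h.at (e.symm u) (frameAt e u (signMap v)) (frameAt e u (signMap w)) =
        h.at (e.symm u) (frameAt e u v) (frameAt e u w)) →
          ∀ v, P (signMap v) = signMap (P v)) := by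
  set H : Sesq := h.at (e.symm u) with hH
  set F := frameAt e u with hF
  set g : Matrix (Fin 4) (Fin 4) ℂ := Matrix.of fun α β =>
    H (F (Pi.single α 1)) (F (Pi.single β 1)) with hg
  have hexp : ∀ v w : C4, H (F v) (F w) = ∑ α, ∑ β, v α * g α β * starRingEnd ℂ (w β) := by
    have hF' : ∀ v : C4, F v = ∑ α, v α • F (Pi.single α 1) := by
      intro v
      conv_lhs => rw [pi_eq_sum_univ' v]
      rw [map_sum]
      exact Finset.sum_congr rfl fun α _ => by rw [map_smul]
    intro v w
    rw [hF' v, hF' w]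
    simp only [map_sum, map_smul, map_smulₛₗ, _root_.sum_apply, _root_.smul_apply, smul_eq_mul,
      Finset.mul_sum, hg, Matrix.of_apply]
    rw [Finset.sum_comm]
    refine Finset.sum_congr rfl fun α _ => Finset.sum_congr rfl fun β _ => ?_
    ring
  have hsymm : ∀ v w, H w v = starRingEnd ℂ (H v w) := h.conj_symm (e.symm u)
  have hgh : g.IsHermitian := by
    ext α β
    exact (hsymm _ _).symm
  have hgp : g.PosDef := by
    refine Matrix.PosDef.of_dotProduct_mulVec_pos hgh fun x hx => ?_
    -- The form is linear in the first variable, hence the conjugation.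
    set y : C4 := fun a => starRingEnd ℂ (x a) with hy
    have hy0 : y ≠ 0 := by
      intro h0
      apply hx
      funext a
      have := congrFun h0 a
      simpa [hy] using this
    have hval : star x ⬝ᵥ (g.mulVec x) = H (F y) (F y) := by
      rw [hexp]
      simp only [dotProduct, Matrix.mulVec, Finset.mul_sum, hy, Complex.conj_conj, Pi.star_apply,
        RCLike.star_def]
      exact Finset.sum_congr rfl fun α _ => Finset.sum_congr rfl fun β _ => by ring
    rw [hval, Complex.pos_iff]
    refine ⟨h.pos (e.symm u) (F y) fun h0 => hy0 ?_, ?_⟩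
    · exact frameAt_injective he hu (h0.trans (map_zero F).symm)
    · have := congrArg Complex.im (hsymm (F y) (F y))
      rw [Complex.conj_im] at this
      linarith
  obtain ⟨R, hRu, hRh, hRg, hRc⟩ := exists_invSqrt hgp
  have hRt : IsUnit R.transpose := by
    rw [Matrix.isUnit_iff_isUnit_det, Matrix.det_transpose]
    exact (Matrix.isUnit_iff_isUnit_det _).1 hRu
  -- With `Pᵀ = R` Hermitian, the new matrix `Pᵀ * g * conj P` is `R * g * R`.
  set P : C4 ≃L[ℂ] C4 :=
    (Matrix.toLinearEquiv' R.transpose hRt.invertible).toContinuousLinearEquiv with hP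
  have hPa : ∀ v, P v = R.transpose.mulVec v := fun v => rfl
  have hPs : ∀ α γ, P (Pi.single α 1) γ = R α γ := by
    intro α γ
    rw [hPa, Matrix.mulVec_single_one]
    rfl
  refine ⟨P, ?_, fun hS v => ?_⟩
  · have hu1 : linChart e P (e.symm u) = P.symm u := by
      rw [linChart_apply, e.right_inv hu]
    have hu2 : P.symm u ∈ (linChart e P).target := by
      rw [mem_target_linChart, P.apply_symm_apply]
      exact hu
    rw [hu1]
    ext α β
    rw [metricCoeff_apply h.form (linChart_mem_maximalAtlas he) hu2,
      frameAt_linChart he (mem_target_linChart.1 hu2),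
      frameAt_linChart he (mem_target_linChart.1 hu2), linChart_symm_apply,
      P.apply_symm_apply]
    change H (F _) (F _) = _
    rw [hexp, ← hRg]
    simp only [hPs, Matrix.mul_apply, Finset.sum_mul]
    rw [Finset.sum_comm]
    refine Finset.sum_congr rfl fun δ _ => Finset.sum_congr rfl fun γ _ => ?_
    congr 1
    exact hRh.apply _ _
  · have hcomm : Commute g (Matrix.diagonal blockSign) := by
      ext α β
      rw [Matrix.mul_diagonal, Matrix.diagonal_mul]
      have h1 := hS (Pi.single α 1) (Pi.single β 1)
      have h2 : ∀ α, signMap (Pi.single α 1) = blockSign α • (Pi.single α 1 : C4) := by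
        intro α
        ext γ
        by_cases hγ : γ = α
        · subst hγ; simp
        · simp [hγ]
      rw [h2, h2, map_smul, map_smul, map_smul, map_smulₛₗ, _root_.smul_apply, smul_eq_mul,
        smul_eq_mul, conj_blockSign] at h1
      change blockSign β * (blockSign α * g α β) = g α β at h1
      linear_combination blockSign α * h1 -
        (blockSign β * g α β) * blockSign_mul_self α
    have hc := congrArg Matrix.transpose (hRc _ hcomm).eq
    rw [Matrix.transpose_mul, Matrix.transpose_mul, Matrix.diagonal_transpose] at hc
    have hsv : ∀ w : C4, signMap w = (Matrix.diagonal blockSign).mulVec w := fun w => by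
      ext a
      rw [Matrix.mulVec_diagonal]
      rfl
    rw [hPa, hPa, hsv, hsv, Matrix.mulVec_mulVec, Matrix.mulVec_mulVec, hc]

end OrthonormalChart

/-! ### Existence of adapted metrics -/

/-- On a compact manifold a locally split form has an adapted metric. -/
theorem IsLocallySplit.exists_isAdapted [IsManifold 𝓘(ℂ, C4) ω M] [T2Space M] [CompactSpace M]
    {ψ : DForm M 4} (hψ : IsLocallySplit ψ) : ∃ h : HermitianMetric M, h.IsAdapted ψ := by
  choose E hEm hEs hE using hψ
  obtain ⟨t, ht⟩ := isCompact_univ.elim_finite_subcover (fun x => (E x).source)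
    (fun x => (E x).open_source) fun x _ => Set.mem_iUnion.2 ⟨x, hEs x⟩
  have : IsManifold 𝓘(ℝ, C4) ω M := isManifold_real
  have : IsManifold 𝓘(ℝ, C4) ∞ M := IsManifold.of_le (n := ω) (by simp)
  obtain ⟨ρ, hρ⟩ := SmoothPartitionOfUnity.exists_isSubordinate 𝓘(ℝ, C4) isClosed_univ
    (fun i : t => (E i).source) (fun i => (E i).open_source) (by
      rw [Set.iUnion_subtype]
      simpa using ht)
  have hsupp : ∀ i : t, tsupport (ρ i) ⊆ (E i).source := fun i => hρ i
  have hpos : ∀ x : M, ∃ i : t, 0 < ρ i x := by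
    intro x
    obtain ⟨i, hi⟩ := ρ.exists_pos_of_mem (Set.mem_univ x)
    exact ⟨i, hi⟩
  set h : HermitianMetric M := gluedMetric (e := fun i : t => E i) (ρ := fun i => ρ i)
    (fun i => hEm i) (fun i => (ρ i).contMDiff) (fun i x => ρ.nonneg i x) hsupp hpos with hh
  refine ⟨h, fun z₀ => ?_⟩
  obtain ⟨f, hf, hfe⟩ := hE z₀
  obtain ⟨u, hu, hz⟩ : ∃ u ∈ (E z₀).target, (E z₀).symm u = z₀ :=
    ⟨E z₀ z₀, (E z₀).map_source (hEs z₀), (E z₀).left_inv (hEs z₀)⟩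
  set e := E z₀ with he
  have hem : e ∈ maximalAtlas 𝓘(ℂ, C4) ω M := hEm z₀
  by_cases hf0 : ∃ᶠ y in 𝓝 u, f (conj34 y) ≠ 0
  · -- The splitting is canonical near `z₀`, and all the glued metrics respect it.
    obtain ⟨P, hP1, hP2⟩ := exists_linChart_metricCoeff_eq_one h hem hu
    rw [hz] at hP1
    refine ⟨linChart e P, linChart_mem_maximalAtlas hem, ?_,
      IsSplitIn.linChart hem ⟨f, hf, hfe⟩ (hP2 fun v w => ?_), hP1⟩
    · exact hEs z₀
    · change gluedForm _ _ _ _ _ = gluedForm _ _ _ _ _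
      rw [gluedForm_apply, gluedForm_apply]
      refine Finset.sum_congr rfl fun i _ => ?_
      by_cases hi : e.symm u ∈ (E i).source
      · have hcom := fderiv_transition_signMap (hEm i) hem (hE i) hu hi hf0 hfe
        congr 1
        have := pullSesq_signMap _ hcom v w
        rw [pullSesq_apply, pullSesq_apply] at this ⊢
        simpa only [coframeAt_frameAt (hEm i) hem hu hi] using this
      · have : ρ i (e.symm u) = 0 := by
          by_contra h0
          exact hi (hsupp i (subset_tsupport _ h0))
        simp [this]
  · -- The form vanishes near `z₀`, so that every coordinate system splits it.
    rw [not_frequently] at hf0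
    obtain ⟨V, hV, hVo, huV⟩ := eventually_nhds_iff.1 hf0
    set s : Set M := e.source ∩ e ⁻¹' V with hs
    have hso : IsOpen s := e.isOpen_inter_preimage hVo
    set e₁ := e.restr s with he₁
    have he₁m : e₁ ∈ maximalAtlas 𝓘(ℂ, C4) ω M :=
      restr_mem_maximalAtlas (contDiffGroupoid ω 𝓘(ℂ, C4)) hem hso
    have he₁t : ∀ y ∈ e₁.target, y ∈ e.target ∧ y ∈ V := by
      intro y hy
      have hy' : y ∈ e.target ∧ e.symm y ∈ s := by
        simpa [he₁, hso.interior_eq] using hy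
      refine ⟨hy'.1, ?_⟩
      have := hy'.2.2
      rwa [Set.mem_preimage, e.right_inv hy'.1] at this
    have hu₁ : u ∈ e₁.target := by
      have : u ∈ e.target ∧ e.symm u ∈ s := by
        refine ⟨hu, e.map_target hu, ?_⟩
        rwa [Set.mem_preimage, e.right_inv hu]
      simpa [he₁, hso.interior_eq] using this
    have hz₁ : e₁.symm u = z₀ := hz
    obtain ⟨P, hP1, -⟩ := exists_linChart_metricCoeff_eq_one h he₁m hu₁
    rw [hz₁] at hP1
    refine ⟨linChart e₁ P, linChart_mem_maximalAtlas he₁m, ?_, ?_, hP1⟩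
    · rw [linChart_source, ← hz₁]
      exact e₁.map_target hu₁
    · refine ⟨0, differentiableOn_const 0, fun y hy v => ?_⟩
      have hy' := he₁t _ (mem_target_linChart.1 hy)
      rw [inChart_linChart ψ he₁m (mem_target_linChart.1 hy)]
      have h1 : inChart ψ e₁ (P y) = inChart ψ e (P y) := rfl
      have h2 : f (conj34 (P y)) = 0 := not_not.1 (hV _ hy'.2)
      rw [h1, hfe _ hy'.1, h2]
      simp

end Existence

end ComplexFourfold

end


theorem lemma3p3 {M : Type*} [TopologicalSpace M] [T2Space M] [CompactSpace M]
    [ChartedSpace ComplexFourfold.C4 M] [IsManifold 𝓘(ℂ, ComplexFourfold.C4) ω M]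
    (ψ : ComplexFourfold.DForm M 4) (hψ : ComplexFourfold.IsLocallySplit ψ) :
    (∃ h : ComplexFourfold.HermitianMetric M, h.IsAdapted ψ) ∧
      ∀ h : ComplexFourfold.HermitianMetric M, h.IsAdapted ψ →
        h.laplacian (k := 3) (l := 3) rfl ψ = 0 :=
  ⟨hψ.exists_isAdapted, fun _ hh => hh.laplacian_eq_zero⟩
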